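/- Let $m,n\ge 0$ be integers and let $p\in\mathbb{C}$ (in the application $p$ is a positive integer, the order of the parastatistics). Let $\mathfrak{g}=\mathfrak{osp}(2m+1|2n)$ be the complex Lie superalgebra of matrices of the form $$\begin{pmatrix} a&b&u&x&x_1\\ c&-a^t&v&y&y_1\\ -v^t&-u^t&0&z&z_1\\ y_1^t&x_1^t&z_1^t&d&e\\ -y^t&-x^t&-z^t&f&-d^t\end{pmatrix}$$ with blocks of sizes $m,m,1,n,n$, $b,c$ antisymmetric and $e,f$ symmetric, graded so that the even part is $x=y=x_1=y_1=0$, $z=z_1=0$ and the odd part is $a=b=c=0$, $u=v=0$, $d=e=f=0$, with superbracket $[\![X,Y]\!]=XY-(-1)^{\deg X\deg Y}YX$. With $e_{rs}$ the matrix units, put $$c_i^+=\sqrt2\,(e_{i,2m+1}-e_{2m+1,i+m}),\quad c_i^-=\sqrt2\,(e_{2m+1,i}-e_{i+m,2m+1}),\quad h_i=e_{ii}-e_{i+m,i+m}\qquad(1\le i\le m),$$ $$c_{m+j}^+=\sqrt2\,(e_{2m+1,2m+1+n+j}+e_{2m+1+j,2m+1}),\quad c_{m+j}^-=\sqrt2\,(e_{2m+1,2m+1+j}-e_{2m+1+n+j,2m+1}),$$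 $$h_{m+j}=e_{2m+1+j,2m+1+j}-e_{2m+1+n+j,2m+1+n+j}\qquad(1\le j\le n),$$ so that $c_j^\pm$ is even for $j\le m$ and odd for $j>m$. Let $\mathcal{P}=\mathrm{span}\{c_j^-,\,[\![c_j^+,c_k^-]\!],\,[\![c_j^-,c_k^-]\!] : 1\le j,k\le m+n\}$, and let $\mathbb{C}|0\rangle$ be the one-dimensional $\mathcal{P}$-module with $c_j^-|0\rangle=0$ and $[\![c_j^-,c_k^+]\!]|0\rangle=p\,\delta_{jk}|0\rangle$, on which $(h_1,\dots,h_{m+n})$ has the weight $(-\tfrac p2,\dots,-\tfrac p2|\tfrac p2,\dots,\tfrac p2)$. Let $$\overline V(p)=\mathrm{Ind}_{\mathcal{P}}^{\mathfrak{g}}\,\mathbb{C}|0\rangle=U(\mathfrak{g})\otimes_{U(\mathcal{P})}\mathbb{C}|0\rangle .$$ 1. The vectors $$(c_1^+)^{k_1}\cdots(c_{m+n}^+)^{k_{m+n}}\,([\![c_1^+,c_2^+]\!])^{k_{12}}([\![c_1^+,c_3^+]\!])^{k_{13}}\cdots([\![c_{m+n-1}^+,c_{m+n}^+]\!])^{k_{m+n-1,m+n}}|0\rangle,$$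 where the pairs $j<k$ are taken in lexicographic order, $k_j\in\mathbb{Z}_{\ge0}$ for all $j$, $k_{jk}\in\mathbb{Z}_{\ge0}$ if $j<k\le m$ or $m<j<k$, and $k_{jk}\in\{0,1\}$ if $j\le m<k$, form a basis of $\overline V(p)$ over $\mathbb{C}$ (distinct exponents giving distinct vectors). 2. $\overline V(p)$ is the sum of its weight spaces for $h_1,\dots,h_{m+n}$, all of them are finite-dimensional, and the formal character $\mathrm{ch}\,\overline V(p)=\sum_\mu \dim \overline V(p)_\mu\, x_1^{\mu_1}\cdots x_m^{\mu_m}y_1^{\mu_{m+1}}\cdots y_n^{\mu_{m+n}}$ is $$\mathrm{ch}\,\overline V(p)=\frac{\prod_{i=1}^m x_i^{-p/2}\ \prod_{j=1}^n y_j^{p/2}\ \prod_{i=1}^m\prod_{j=1}^n(1+x_iy_j)}{\prod_{i}(1-x_i)\prod_{i<k}(1-x_ix_k)\prod_{j}(1-y_j)\prod_{j<l}(1-y_jy_l)},$$ where $1\le i,k\le m$, $1\le j,l\le n$, and the quotient is expanded as a power series in $x_1,\dots,x_m,y_1,\dots,y_n$. -/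

import Mathlib

open scoped TensorProduct Matrix

noncomputable section

namespace Osp

/-! ### Supermatrices -/

/-- Row and column indices of `(2m+1|2n)`-supermatrices, in five consecutive groups of sizes
`m, m, 1 | n, n`; the first three groups are even, the last two are odd. -/
abbrev Idx (m n : ℕ) : Type := (Fin m ⊕ (Fin m ⊕ Unit)) ⊕ (Fin n ⊕ Fin n)

abbrev SMat (m n : ℕ) : Type := Matrix (Idx m n) (Idx m n) ℂ

/-- The homogeneous component of parity `a`: the diagonal blocks for `a = 0`, the off-diagonal
blocks for `a = 1`. -/
def part {m n : ℕ} (a : ZMod 2) (X : SMat m n) : SMat m n :=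
  if a = 0 then Matrix.fromBlocks X.toBlocks₁₁ 0 0 X.toBlocks₂₂
  else Matrix.fromBlocks 0 X.toBlocks₁₂ X.toBlocks₂₁ 0

def IsHomogeneous {m n : ℕ} (a : ZMod 2) (X : SMat m n) : Prop := part a X = X

/-- The sign `(-1)^{ab}`. -/
def superSign (a b : ZMod 2) : ℂ := if a = 1 ∧ b = 1 then -1 else 1

/-- The supercommutator `⟦X, Y⟧ = XY - (-1)^{deg X deg Y} YX` of homogeneous supermatrices,
extended bilinearly. -/
def superBracket {m n : ℕ} (X Y : SMat m n) : SMat m n :=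
  ∑ a : ZMod 2, ∑ b : ZMod 2,
    (part a X * part b Y - superSign a b • (part b Y * part a X))

/-! ### The Lie superalgebra `osp(2m+1|2n)` -/

/-- The supermatrix with rows
`(a, b, u, x, x₁)`, `(c, -aᵗ, v, y, y₁)`, `(-vᵗ, -uᵗ, 0, z, z₁)`,
`(y₁ᵗ, x₁ᵗ, z₁ᵗ, d, e)`, `(-yᵗ, -xᵗ, -zᵗ, f, -dᵗ)`. -/
def ospMatrix {m n : ℕ} (a b c : Matrix (Fin m) (Fin m) ℂ) (u v : Matrix (Fin m) Unit ℂ)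
    (x y x₁ y₁ : Matrix (Fin m) (Fin n) ℂ) (z z₁ : Matrix Unit (Fin n) ℂ)
    (d e f : Matrix (Fin n) (Fin n) ℂ) : SMat m n :=
  Matrix.fromBlocks
    (Matrix.fromBlocks a (Matrix.fromCols b u)
      (Matrix.fromRows c (-vᵀ))
      (Matrix.fromBlocks (-aᵀ) v (-uᵀ) 0))
    (Matrix.fromRows (Matrix.fromCols x x₁)
      (Matrix.fromRows (Matrix.fromCols y y₁) (Matrix.fromCols z z₁)))
    (Matrix.fromRows (Matrix.fromCols y₁ᵀ (Matrix.fromCols x₁ᵀ z₁ᵀ))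
      (Matrix.fromCols (-yᵀ) (Matrix.fromCols (-xᵀ) (-zᵀ))))
    (Matrix.fromBlocks d e f (-dᵀ))

/-- The block form of the elements of `osp(2m+1|2n)`. -/
def IsOsp {m n : ℕ} (X : SMat m n) : Prop :=
  ∃ (a b c : Matrix (Fin m) (Fin m) ℂ) (u v : Matrix (Fin m) Unit ℂ)
    (x y x₁ y₁ : Matrix (Fin m) (Fin n) ℂ) (z z₁ : Matrix Unit (Fin n) ℂ)
    (d e f : Matrix (Fin n) (Fin n) ℂ),
    bᵀ = -b ∧ cᵀ = -c ∧ eᵀ = e ∧ fᵀ = f ∧ X = ospMatrix a b c u v x y x₁ y₁ z z₁ d e f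

/-! For the proof that `osp(2m+1|2n)` is closed under the superbracket, its elements are also
described by linear equations between the entries. -/

/-- The involution of the indices that exchanges the first two groups and the last two groups. -/
def bar {m n : ℕ} : Idx m n → Idx m n
  | .inl (.inl i) => .inl (.inr (.inl i))
  | .inl (.inr (.inl i)) => .inl (.inl i)
  | .inl (.inr (.inr u)) => .inl (.inr (.inr u))
  | .inr (.inl j) => .inr (.inr j)
  | .inr (.inr j) => .inr (.inl j)

/-- The signs in the description of `osp(2m+1|2n)` by entries. -/
def eta {m n : ℕ} : Idx m n → ℂ
  | .inr (.inr _) => -1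
  | _ => 1

/-- The parity of an index. -/
def par {m n : ℕ} : Idx m n → ZMod 2
  | .inl _ => 0
  | .inr _ => 1

theorem isOsp_iff {m n : ℕ} (X : SMat m n) :
    IsOsp X ↔ ∀ i j, eta i * X (bar i) j = -(superSign (par i) (par j) * (eta j * X (bar j) i)) := by
  constructor
  · rintro ⟨a, b, c, u, v, x, y, x₁, y₁, z, z₁, d, e, f, hb, hc, he, hf, rfl⟩
    have hb' : ∀ i j, b j i = - b i j := fun i j => congrFun (congrFun hb i) j
    have hc' : ∀ i j, c j i = - c i j := fun i j => congrFun (congrFun hc i) j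
    have he' : ∀ i j, e j i = e i j := fun i j => congrFun (congrFun he i) j
    have hf' : ∀ i j, f j i = f i j := fun i j => congrFun (congrFun hf i) j
    rintro ((i | i | i) | (i | i)) ((j | j | j) | (j | j)) <;>
      simp [ospMatrix, bar, eta, par, superSign]
    · exact hc' j i
    · exact hb' j i
    · exact hf' j i
    · exact he' j i
  · intro h
    refine ⟨.of fun i j => X (.inl (.inl i)) (.inl (.inl j)),
      .of fun i j => X (.inl (.inl i)) (.inl (.inr (.inl j))),
      .of fun i j => X (.inl (.inr (.inl i))) (.inl (.inl j)),
      .of fun i j => X (.inl (.inl i)) (.inl (.inr (.inr j))),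
      .of fun i j => X (.inl (.inr (.inl i))) (.inl (.inr (.inr j))),
      .of fun i j => X (.inl (.inl i)) (.inr (.inl j)),
      .of fun i j => X (.inl (.inr (.inl i))) (.inr (.inl j)),
      .of fun i j => X (.inl (.inl i)) (.inr (.inr j)),
      .of fun i j => X (.inl (.inr (.inl i))) (.inr (.inr j)),
      .of fun i j => X (.inl (.inr (.inr i))) (.inr (.inl j)),
      .of fun i j => X (.inl (.inr (.inr i))) (.inr (.inr j)),
      .of fun i j => X (.inr (.inl i)) (.inr (.inl j)),
      .of fun i j => X (.inr (.inl i)) (.inr (.inr j)),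
      .of fun i j => X (.inr (.inr i)) (.inr (.inl j)), ?_, ?_, ?_, ?_, ?_⟩
    · ext i j
      simpa [bar, eta, par, superSign] using h (.inl (.inr (.inl j))) (.inl (.inr (.inl i)))
    · ext i j
      simpa [bar, eta, par, superSign] using h (.inl (.inl j)) (.inl (.inl i))
    · ext i j
      simpa [bar, eta, par, superSign] using h (.inr (.inr j)) (.inr (.inr i))
    · ext i j
      simpa [bar, eta, par, superSign] using h (.inr (.inl j)) (.inr (.inl i))
    · ext i j
      have hh := h (bar i) j
      rcases i with (i | i | i) | (i | i) <;> rcases j with (j | j | j) | (j | j) <;>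
        simp [ospMatrix, bar, eta, par, superSign] at hh ⊢ <;> first | exact hh | exact self_eq_neg.mp hh


theorem part_apply {m n : ℕ} (a : ZMod 2) (X : SMat m n) (i j : Idx m n) :
    part a X i j = if par i + par j = a then X i j else 0 := by
  have h11 : (1 : ZMod 2) + 1 = 0 := by decide
  have h10 : (1 : ZMod 2) ≠ 0 := by decide
  obtain rfl | rfl : a = 0 ∨ a = 1 := by revert a; decide
  all_goals
    rcases i with i | i <;> rcases j with j | j <;>
      simp [part, par, h11, Matrix.toBlocks₁₁, Matrix.toBlocks₁₂, Matrix.toBlocks₂₁,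
        Matrix.toBlocks₂₂]

theorem par_bar {m n : ℕ} (i : Idx m n) : par (bar i) = par i := by
  rcases i with (i | i | i) | (i | i) <;> rfl

theorem bar_bar {m n : ℕ} (i : Idx m n) : bar (bar i) = i := by
  rcases i with (i | i | i) | (i | i) <;> rfl

theorem eta_bar {m n : ℕ} (i : Idx m n) : eta (bar i) = superSign (par i) (par i) * eta i := by
  rcases i with (i | i | i) | (i | i) <;> simp [bar, eta, par, superSign]

theorem superSign_aux (i j k : ZMod 2) :
    superSign i k * superSign k k * superSign k j =
      superSign (k + i) (j + k) * superSign i j := by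
  have h11 : (1 : ZMod 2) + 1 = 0 := by decide
  obtain rfl | rfl : i = 0 ∨ i = 1 := by revert i; decide
  all_goals obtain rfl | rfl : j = 0 ∨ j = 1 := by revert j; decide
  all_goals obtain rfl | rfl : k = 0 ∨ k = 1 := by revert k; decide
  all_goals simp [superSign, h11]

theorem superSign_mul_self (a b : ZMod 2) : superSign a b * superSign a b = 1 := by
  unfold superSign; split_ifs <;> norm_num

theorem isOsp_part {m n : ℕ} (a : ZMod 2) {X : SMat m n} (h : IsOsp X) : IsOsp (part a X) := by
  rw [isOsp_iff] at h ⊢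
  intro i j
  have := h i j
  simp only [part_apply, par_bar, add_comm (par j) (par i)]
  split_ifs
  · exact this
  · simp

theorem isOsp_mul_aux {m n : ℕ} (a b : ZMod 2) {X Y : SMat m n} (hX : IsOsp X) (hY : IsOsp Y)
    (i j : Idx m n) :
    eta i * (part a X * part b Y) (bar i) j =
      superSign a b * superSign (par i) (par j) * (eta j * (part b Y * part a X) (bar j) i) := by
  have hX' := (isOsp_iff _).1 (isOsp_part a hX)
  have hY' := (isOsp_iff _).1 (isOsp_part b hY)
  let e : Idx m n ≃ Idx m n := ⟨bar, bar, bar_bar, bar_bar⟩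
  rw [Matrix.mul_apply, Matrix.mul_apply, ← Equiv.sum_comp e, Finset.mul_sum, Finset.mul_sum,
    Finset.mul_sum]
  refine Finset.sum_congr rfl fun k _ => ?_
  change eta i * (part a X (bar i) (bar k) * part b Y (bar k) j) = _
  have h1 := hX' i (bar k)
  rw [bar_bar, par_bar, eta_bar] at h1
  have h2 := hY' k j
  have h3 : part b Y (bar j) k * part a X k i * (superSign (par i) (par k) *
      superSign (par k) (par k) * superSign (par k) (par j)) =
      part b Y (bar j) k * part a X k i * (superSign a b * superSign (par i) (par j)) := by
    rw [superSign_aux]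
    simp only [part_apply, par_bar]
    split_ifs with g1 g2 <;> simp_all
  linear_combination (part b Y (bar k) j) * h1 - superSign (par i) (par k) *
    superSign (par k) (par k) * part a X k i * h2 + eta j * h3

theorem isOsp_zero {m n : ℕ} : IsOsp (0 : SMat m n) := by
  rw [isOsp_iff]; simp

theorem IsOsp.add {m n : ℕ} {X Y : SMat m n} (hX : IsOsp X) (hY : IsOsp Y) : IsOsp (X + Y) := by
  rw [isOsp_iff] at hX hY ⊢
  intro i j
  simp only [Matrix.add_apply]
  linear_combination hX i j + hY i j

theorem IsOsp.smul {m n : ℕ} (r : ℂ) {X : SMat m n} (hX : IsOsp X) : IsOsp (r • X) := by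
  rw [isOsp_iff] at hX ⊢
  intro i j
  simp only [Matrix.smul_apply, smul_eq_mul]
  linear_combination r * hX i j

/-- The Lie superalgebra `osp(2m+1|2n)`, as a complex vector space of supermatrices. -/
def osp (m n : ℕ) : Submodule ℂ (SMat m n) where
  carrier := {X | IsOsp X}
  zero_mem' := isOsp_zero
  add_mem' := IsOsp.add
  smul_mem' r _ := IsOsp.smul r

theorem superBracket_mem {m n : ℕ} {X Y : SMat m n} (hX : X ∈ osp m n) (hY : Y ∈ osp m n) :
    superBracket X Y ∈ osp m n := by
  refine Submodule.sum_mem _ fun a _ => Submodule.sum_mem _ fun b _ => ?_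
  change IsOsp _
  rw [isOsp_iff]
  intro i j
  have h1 := isOsp_mul_aux a b hX hY i j
  have h2 := isOsp_mul_aux a b hX hY j i
  have h3 := superSign_mul_self a b
  have h4 := superSign_mul_self (par i) (par j)
  have h5 : superSign (par j) (par i) = superSign (par i) (par j) := by
    simp [superSign, and_comm]
  rw [h5] at h2
  simp only [Matrix.sub_apply, Matrix.smul_apply, smul_eq_mul]
  linear_combination h1 + superSign (par i) (par j) * h2 +
    eta i * superSign a b * (part b Y * part a X) (bar i) j * h4

/-- The Lie superbracket of `osp(2m+1|2n)`. -/
def bracket {m n : ℕ} (X Y : osp m n) : osp m n :=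
  ⟨superBracket X.1 Y.1, superBracket_mem X.2 Y.2⟩

/-! ### Generators and Cartan elements

The generators are indexed by `j = 0, …, m + n - 1`: the first `m` values of `j` are the
parafermions, the last `n` values are the parabosons. -/

/-- The degree `⟨j⟩` of `c_j^±`. -/
def deg {m n : ℕ} (j : Fin (m + n)) : ZMod 2 := if (j : ℕ) < m then 0 else 1

/-- The index of the row `i` (for `j = i ≤ m`), and of the row `2m+1+i` (for `j = m + i`). -/
def top {m n : ℕ} (j : Fin (m + n)) : Idx m n :=
  Fin.addCases (fun i => .inl (.inl i)) (fun i => .inr (.inl i)) j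

/-- The index of the row `m+i` (for `j = i ≤ m`), and of the row `2m+1+n+i` (for `j = m + i`). -/
def bot {m n : ℕ} (j : Fin (m + n)) : Idx m n :=
  Fin.addCases (fun i => .inl (.inr (.inl i))) (fun i => .inr (.inr i)) j

/-- The index of the row `2m+1`. -/
def mid {m n : ℕ} : Idx m n := .inl (.inr (.inr ()))

@[simp] theorem deg_castAdd {m n : ℕ} (i : Fin m) : deg (Fin.castAdd n i) = 0 := by
  simp [deg]

@[simp] theorem deg_natAdd {m n : ℕ} (i : Fin n) : deg (Fin.natAdd m i) = 1 := by
  simp [deg]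

@[simp] theorem top_castAdd {m n : ℕ} (i : Fin m) : top (Fin.castAdd n i) = .inl (.inl i) := by
  simp [top]

@[simp] theorem top_natAdd {m n : ℕ} (i : Fin n) : top (Fin.natAdd m i) = .inr (.inl i) := by
  simp [top]

@[simp] theorem bot_castAdd {m n : ℕ} (i : Fin m) :
    bot (Fin.castAdd n i) = .inl (.inr (.inl i)) := by
  simp [bot]

@[simp] theorem bot_natAdd {m n : ℕ} (i : Fin n) : bot (Fin.natAdd m i) = .inr (.inr i) := by
  simp [bot]

/-- `c_j^+ = √2 (e_{j,2m+1} - e_{2m+1,j+m})` for `j ≤ m`, and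
`c_{m+j}^+ = √2 (e_{2m+1+j,2m+1} + e_{2m+1,2m+1+n+j})`. -/
def cPlus {m n : ℕ} (j : Fin (m + n)) : osp m n :=
  ⟨((Real.sqrt 2 : ℝ) : ℂ) •
      (Matrix.single (top j) mid 1 - superSign (deg j) (deg j) • Matrix.single mid (bot j) 1), by
    refine Submodule.smul_mem _ _ ?_
    change IsOsp _
    rw [isOsp_iff]
    intro i k
    induction j using Fin.addCases with
    | left j | right j =>
      rcases i with (i | i | i) | (i | i) <;> rcases k with (k | k | k) | (k | k) <;>
        simp [Matrix.single_apply, bar, eta, par, superSign, mid] <;> split_ifs <;> simp⟩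

/-- `c_j^- = √2 (e_{2m+1,j} - e_{j+m,2m+1})` for `j ≤ m`, and
`c_{m+j}^- = √2 (e_{2m+1,2m+1+j} - e_{2m+1+n+j,2m+1})`. -/
def cMinus {m n : ℕ} (j : Fin (m + n)) : osp m n :=
  ⟨((Real.sqrt 2 : ℝ) : ℂ) • (Matrix.single mid (top j) 1 - Matrix.single (bot j) mid 1), by
    refine Submodule.smul_mem _ _ ?_
    change IsOsp _
    rw [isOsp_iff]
    intro i k
    induction j using Fin.addCases with
    | left j | right j =>
      rcases i with (i | i | i) | (i | i) <;> rcases k with (k | k | k) | (k | k) <;>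
        simp [Matrix.single_apply, bar, eta, par, superSign, mid]⟩

/-- The basis `h_j = e_{j,j} - e_{j+m,j+m}` (`j ≤ m`) and
`h_{m+j} = e_{2m+1+j,2m+1+j} - e_{2m+1+n+j,2m+1+n+j}` of the Cartan subalgebra. -/
def cartan {m n : ℕ} (j : Fin (m + n)) : osp m n :=
  ⟨Matrix.single (top j) (top j) 1 - Matrix.single (bot j) (bot j) 1, by
    change IsOsp _
    rw [isOsp_iff]
    intro i k
    induction j using Fin.addCases with
    | left j | right j =>
      rcases i with (i | i | i) | (i | i) <;> rcases k with (k | k | k) | (k | k) <;>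
        simp [Matrix.single_apply, bar, eta, par, superSign, and_comm]⟩

/-- The subspace `𝒫` spanned by all `c_j^-`, `⟦c_j^+, c_k^-⟧`, `⟦c_j^-, c_k^-⟧`. -/
def parabolic (m n : ℕ) : Submodule ℂ (osp m n) :=
  Submodule.span ℂ
    (Set.range cMinus ∪ {X | ∃ j k, X = bracket (cPlus j) (cMinus k)} ∪
      {X | ∃ j k, X = bracket (cMinus j) (cMinus k)})

/-- The weight `(-p/2, …, -p/2 | p/2, …, p/2)`. -/
def lowestWeight {m n : ℕ} (p : ℂ) (j : Fin (m + n)) : ℂ :=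
  if (j : ℕ) < m then -(p / 2) else p / 2

/-- The linear functional by which `𝒫` acts on the vacuum `|0⟩`: it vanishes on the `c_j^-` and
the `⟦c_j^-, c_k^-⟧`, and is `p δ_{jk}` on `⟦c_j^-, c_k^+⟧`. On the diagonal matrices it is the
weight `(-p/2, …, -p/2 | p/2, …, p/2)`. -/
def vacuumFunctional {m n : ℕ} (p : ℂ) : osp m n →ₗ[ℂ] ℂ where
  toFun X := ∑ j, lowestWeight p j * X.1 (top j) (top j)
  map_add' X Y := by simp [mul_add, Finset.sum_add_distrib]
  map_smul' r X := by simp [Finset.mul_sum, mul_left_comm]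

theorem vacuumFunctional_apply {m n : ℕ} (p : ℂ) (X : osp m n) :
    vacuumFunctional p X = ∑ j, lowestWeight p j * X.1 (top j) (top j) := rfl

/-! Checks: `𝒫` is a subsuperalgebra and the functional makes `ℂ|0⟩` a `𝒫`-module. -/

theorem idx_cases {m n : ℕ} (i : Idx m n) :
    (∃ s, i = top s) ∨ (∃ s, i = bot s) ∨ i = mid := by
  rcases i with (i | i | i) | (i | i)
  · exact .inl ⟨Fin.castAdd n i, by simp⟩
  · exact .inr (.inl ⟨Fin.castAdd n i, by simp⟩)
  · exact .inr (.inr rfl)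
  · exact .inl ⟨Fin.natAdd m i, by simp⟩
  · exact .inr (.inl ⟨Fin.natAdd m i, by simp⟩)

theorem top_inj {m n : ℕ} (s t : Fin (m + n)) : (top s : Idx m n) = top t ↔ s = t := by
  refine ⟨fun h => ?_, fun h => h ▸ rfl⟩
  induction s using Fin.addCases <;> induction t using Fin.addCases <;> simp_all

theorem bot_inj {m n : ℕ} (s t : Fin (m + n)) : (bot s : Idx m n) = bot t ↔ s = t := by
  refine ⟨fun h => ?_, fun h => h ▸ rfl⟩
  induction s using Fin.addCases <;> induction t using Fin.addCases <;> simp_all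

theorem top_ne_bot {m n : ℕ} (s t : Fin (m + n)) : (top s : Idx m n) ≠ bot t := by
  induction s using Fin.addCases <;> induction t using Fin.addCases <;> simp

theorem top_ne_mid {m n : ℕ} (s : Fin (m + n)) : (top s : Idx m n) ≠ mid := by
  induction s using Fin.addCases <;> simp [mid]

theorem bot_ne_mid {m n : ℕ} (s : Fin (m + n)) : (bot s : Idx m n) ≠ mid := by
  induction s using Fin.addCases <;> simp [mid]

theorem par_top {m n : ℕ} (s : Fin (m + n)) : par (top s) = deg s := by
  induction s using Fin.addCases <;> simp [par]

theorem par_bot {m n : ℕ} (s : Fin (m + n)) : par (bot s) = deg s := by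
  induction s using Fin.addCases <;> simp [par]

theorem par_mid {m n : ℕ} : par (mid : Idx m n) = 0 := rfl

theorem bar_top {m n : ℕ} (s : Fin (m + n)) : bar (top s) = bot s := by
  induction s using Fin.addCases <;> simp [bar]

theorem bar_bot {m n : ℕ} (s : Fin (m + n)) : bar (bot s) = top s := by
  induction s using Fin.addCases <;> simp [bar]

theorem bar_mid {m n : ℕ} : bar (mid : Idx m n) = mid := rfl

theorem eta_top {m n : ℕ} (s : Fin (m + n)) : eta (top s) = 1 := by
  induction s using Fin.addCases <;> simp [eta]

theorem eta_bot {m n : ℕ} (s : Fin (m + n)) : eta (bot s) = superSign (deg s) (deg s) := by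
  induction s using Fin.addCases <;> simp [eta, superSign]

theorem eta_mid {m n : ℕ} : eta (mid : Idx m n) = 1 := rfl

theorem sum_idx {m n : ℕ} (f : Idx m n → ℂ) :
    ∑ i, f i = ∑ s, f (top s) + ∑ s, f (bot s) + f mid := by
  simp only [Fintype.sum_sum_type, Fin.sum_univ_add, top_castAdd, top_natAdd, bot_castAdd,
    bot_natAdd]
  simp [mid]
  ring

theorem isHomogeneous_iff {m n : ℕ} (a : ZMod 2) (X : SMat m n) :
    IsHomogeneous a X ↔ ∀ i j, par i + par j ≠ a → X i j = 0 := by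
  constructor
  · intro h i j hij
    rw [← h, part_apply, if_neg hij]
  · intro h
    ext i j
    rw [part_apply]
    split_ifs with g
    · rfl
    · exact (h i j g).symm

theorem part_of_homogeneous {m n : ℕ} {a : ZMod 2} {X : SMat m n} (h : IsHomogeneous a X)
    (b : ZMod 2) : part b X = if b = a then X else 0 := by
  ext i j
  rw [part_apply]
  by_cases hb : b = a
  · subst hb
    rw [if_pos rfl]
    split_ifs with g
    · rfl
    · exact ((isHomogeneous_iff _ _).1 h i j g).symm
  · rw [if_neg hb]
    split_ifs with g
    · exact (isHomogeneous_iff _ _).1 h i j fun g' => hb (g.symm.trans g')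
    · rfl

theorem superBracket_of_homogeneous {m n : ℕ} {a b : ZMod 2} {X Y : SMat m n}
    (hX : IsHomogeneous a X) (hY : IsHomogeneous b Y) :
    superBracket X Y = X * Y - superSign a b • (Y * X) := by
  unfold superBracket
  rw [Finset.sum_eq_single a, Finset.sum_eq_single b]
  · simp [part_of_homogeneous hX, part_of_homogeneous hY]
  · intro c _ hc
    simp [part_of_homogeneous hY, hc]
  · simp
  · intro c _ hc
    simp [part_of_homogeneous hX, hc]
  · simp

theorem isHomogeneous_cPlus {m n : ℕ} (s : Fin (m + n)) :
    IsHomogeneous (deg s) (cPlus s : osp m n).1 := by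
  rw [isHomogeneous_iff]
  intro i j h
  have h1 : ¬ (top s = i ∧ mid = j) := by
    rintro ⟨rfl, rfl⟩; simp [par_top, par_mid] at h
  have h2 : ¬ (mid = i ∧ bot s = j) := by
    rintro ⟨rfl, rfl⟩; simp [par_bot, par_mid] at h
  simp [cPlus, h1, h2]

theorem isHomogeneous_cMinus {m n : ℕ} (s : Fin (m + n)) :
    IsHomogeneous (deg s) (cMinus s : osp m n).1 := by
  rw [isHomogeneous_iff]
  intro i j h
  have h1 : ¬ (mid = i ∧ top s = j) := by
    rintro ⟨rfl, rfl⟩; simp [par_top, par_mid] at h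
  have h2 : ¬ (bot s = i ∧ mid = j) := by
    rintro ⟨rfl, rfl⟩; simp [par_bot, par_mid] at h
  simp [cMinus, h1, h2]

theorem sqrt_two_mul : ((Real.sqrt 2 : ℝ) : ℂ) * ((Real.sqrt 2 : ℝ) : ℂ) = 2 := by
  rw [← Complex.ofReal_mul, Real.mul_self_sqrt (by norm_num)]; norm_num

theorem single_mul_single {m n : ℕ} (i j k l : Idx m n) :
    (Matrix.single i j 1 * Matrix.single k l 1 : SMat m n) =
      if j = k then Matrix.single i l 1 else 0 := by
  split_ifs with h
  · subst h; simp
  · simp [h]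

theorem sqrt_smul_mul {m n : ℕ} (X Y : SMat m n) :
    (((Real.sqrt 2 : ℝ) : ℂ) • X) * (((Real.sqrt 2 : ℝ) : ℂ) • Y) = (2 : ℂ) • (X * Y) := by
  rw [Matrix.smul_mul, Matrix.mul_smul, smul_smul, sqrt_two_mul]

theorem superSign_cases (a b : ZMod 2) : superSign a b = 1 ∨ superSign a b = -1 := by
  unfold superSign; split_ifs <;> simp

theorem superSign_comm (a b : ZMod 2) : superSign a b = superSign b a := by
  simp [superSign, and_comm]

theorem bracket_cPlus_cMinus {m n : ℕ} (s t : Fin (m + n)) :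
    (bracket (cPlus s) (cMinus t) : osp m n).1 =
      (2 : ℂ) • (Matrix.single (top s) (top t) 1 -
        (superSign (deg s) (deg t) * superSign (deg s) (deg s)) •
          Matrix.single (bot t) (bot s) 1) := by
  change superBracket _ _ = _
  rw [superBracket_of_homogeneous (isHomogeneous_cPlus s) (isHomogeneous_cMinus t)]
  simp only [cPlus, cMinus, sqrt_smul_mul]
  simp only [Matrix.smul_mul, Matrix.mul_smul, mul_sub,
    sub_mul, single_mul_single, bot_inj, top_inj, if_true, top_ne_mid, bot_ne_mid,
    (top_ne_mid _).symm, (bot_ne_mid _).symm, if_false]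
  by_cases h : s = t
  · subst h
    obtain h | h := superSign_cases (deg s) (deg s) <;> simp only [h, if_true] <;> module
  · simp only [h, Ne.symm h, if_false]
    module

theorem bracket_cMinus_cMinus {m n : ℕ} (s t : Fin (m + n)) :
    (bracket (cMinus s) (cMinus t) : osp m n).1 =
      (-2 : ℂ) • (Matrix.single (bot s) (top t) 1 -
        superSign (deg s) (deg t) • Matrix.single (bot t) (top s) 1) := by
  change superBracket _ _ = _
  rw [superBracket_of_homogeneous (isHomogeneous_cMinus s) (isHomogeneous_cMinus t)]
  simp only [cMinus, sqrt_smul_mul]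
  simp only [mul_sub, sub_mul, single_mul_single, if_true, top_ne_mid,
    (bot_ne_mid _).symm, if_false, top_ne_bot]
  module

theorem bracket_cMinus_cPlus {m n : ℕ} (s t : Fin (m + n)) :
    (bracket (cMinus s) (cPlus t) : osp m n) =
      -(superSign (deg s) (deg t) • bracket (cPlus t) (cMinus s)) := by
  apply Subtype.ext
  change superBracket _ _ = -(_ • superBracket _ _)
  rw [superBracket_of_homogeneous (isHomogeneous_cMinus s) (isHomogeneous_cPlus t),
    superBracket_of_homogeneous (isHomogeneous_cPlus t) (isHomogeneous_cMinus s)]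
  have : superSign (deg t) (deg s) = superSign (deg s) (deg t) := by simp [superSign, and_comm]
  rw [this]
  obtain h | h := superSign_cases (deg s) (deg t) <;> simp only [h] <;> module

/-- The degree of an index for the `ℤ`-grading of `osp(2m+1|2n)` in which `c_j^±` has
degree `±1`. -/
def level {m n : ℕ} : Idx m n → ℤ
  | .inl (.inl _) => 1
  | .inl (.inr (.inl _)) => -1
  | .inl (.inr (.inr _)) => 0
  | .inr (.inl _) => 1
  | .inr (.inr _) => -1

theorem level_top {m n : ℕ} (s : Fin (m + n)) : level (top s) = 1 := by
  induction s using Fin.addCases <;> simp [level]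

theorem level_bot {m n : ℕ} (s : Fin (m + n)) : level (bot s) = -1 := by
  induction s using Fin.addCases <;> simp [level]

theorem level_mid {m n : ℕ} : level (mid : Idx m n) = 0 := rfl

theorem mem_parabolic_iff {m n : ℕ} (X : osp m n) :
    X ∈ parabolic m n ↔ ∀ i j, level j < level i → X.1 i j = 0 := by
  constructor
  · intro hX
    induction hX using Submodule.span_induction with
    | zero => simp
    | add X Y _ _ hX hY => intro i j h; simp [hX i j h, hY i j h]
    | smul r X _ hX => intro i j h; simp [hX i j h]
    | mem X hX =>
      intro i j h
      have key : ∀ (k l : Idx m n) (r : ℂ), level k ≤ level l → Matrix.single k l r i j = 0 := by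
        intro k l r hkl
        rw [Matrix.single_apply, if_neg]
        rintro ⟨rfl, rfl⟩
        omega
      rcases hX with (⟨s, rfl⟩ | ⟨s, t, rfl⟩) | ⟨s, t, rfl⟩
      · have h1 := fun r => key mid (top s) r (by simp [level_top, level_mid])
        have h2 := fun r => key (bot s) mid r (by simp [level_bot, level_mid])
        simp [cMinus, h1, h2]
      · have h1 := fun r => key (top s) (top t) r (by simp [level_top])
        have h2 := fun r => key (bot t) (bot s) r (by simp [level_bot])
        simp [bracket_cPlus_cMinus, h1, h2]
      · have h1 := fun r => key (bot s) (top t) r (by simp [level_top, level_bot])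
        have h2 := fun r => key (bot t) (top s) r (by simp [level_top, level_bot])
        simp [bracket_cMinus_cMinus, h1, h2]
  · intro hX
    have hsq : ((Real.sqrt 2 : ℝ) : ℂ) ≠ 0 := by
      intro h; have := sqrt_two_mul; rw [h] at this; norm_num at this
    have hdec : X = ∑ s, (X.1 mid (top s) / ((Real.sqrt 2 : ℝ) : ℂ)) • cMinus s +
        ∑ s, ∑ t, (X.1 (top s) (top t) / 2) • bracket (cPlus s) (cMinus t) +
        ∑ s, ∑ t, (-X.1 (bot s) (top t) / 4) • bracket (cMinus s) (cMinus t) := by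
      apply Subtype.ext
      ext i j
      have ho := (isOsp_iff _).1 X.2
      simp only [Submodule.coe_add, Submodule.coe_sum, Submodule.coe_smul, Matrix.add_apply,
        Matrix.sum_apply, Matrix.smul_apply, bracket_cPlus_cMinus, bracket_cMinus_cMinus,
        Matrix.sub_apply, smul_eq_mul]
      simp only [cMinus, Matrix.smul_apply, Matrix.sub_apply, smul_eq_mul]
      obtain ⟨a, rfl⟩ | ⟨a, rfl⟩ | rfl := idx_cases i <;>
      obtain ⟨b, rfl⟩ | ⟨b, rfl⟩ | rfl := idx_cases j <;>
      simp [Matrix.single_apply, top_inj, bot_inj, top_ne_mid, bot_ne_mid, top_ne_bot,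
        (top_ne_mid _).symm, (bot_ne_mid _).symm, (top_ne_bot _ _).symm,
        ite_and, mul_sub, Finset.sum_sub_distrib]
      · exact hX _ _ (by simp [level_top, level_bot])
      · exact hX _ _ (by simp [level_top, level_mid])
      · have h := ho (top a) (top b)
        simp only [bar_top, eta_top, par_top, superSign_comm (deg a)] at h
        linear_combination (1 / 2 : ℂ) * h
      · have h := ho (top a) (bot b)
        simp only [bar_top, bar_bot, eta_top, eta_bot, par_top, par_bot,
          superSign_comm (deg a)] at h
        linear_combination h
      · have h := ho (top a) mid
        simpa [bar_top, bar_mid, eta_top, eta_mid, par_top, par_mid, superSign] using h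
      · exact hX _ _ (by simp [level_bot, level_mid])
      · have h := ho mid mid
        simpa [bar_mid, eta_mid, par_mid, superSign, self_eq_neg] using h
    rw [hdec]
    refine add_mem (add_mem (sum_mem fun s _ => ?_) (sum_mem fun s _ => sum_mem fun t _ => ?_))
      (sum_mem fun s _ => sum_mem fun t _ => ?_) <;>
    refine Submodule.smul_mem _ _ (Submodule.subset_span ?_)
    · exact .inl (.inl ⟨s, rfl⟩)
    · exact .inl (.inr ⟨s, t, rfl⟩)
    · exact .inr ⟨s, t, rfl⟩

theorem part_upper {m n : ℕ} {X : SMat m n} (hX : ∀ i j, level j < level i → X i j = 0)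
    (a : ZMod 2) (i j : Idx m n) (h : level j < level i) : part a X i j = 0 := by
  rw [part_apply, hX i j h, ite_self]

theorem mul_upper {m n : ℕ} {X Y : SMat m n} (hX : ∀ i j, level j < level i → X i j = 0)
    (hY : ∀ i j, level j < level i → Y i j = 0) (i j : Idx m n) (h : level j < level i) :
    (X * Y) i j = 0 := by
  rw [Matrix.mul_apply]
  refine Finset.sum_eq_zero fun k _ => ?_
  by_cases hk : level k < level i
  · rw [hX i k hk, zero_mul]
  · rw [hY k j (by omega), mul_zero]

/-- `𝒫` is closed under the superbracket. -/
theorem bracket_mem_parabolic {m n : ℕ} {X Y : osp m n} (hX : X ∈ parabolic m n)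
    (hY : Y ∈ parabolic m n) : bracket X Y ∈ parabolic m n := by
  rw [mem_parabolic_iff] at hX hY ⊢
  intro i j h
  simp only [bracket, superBracket, Matrix.sum_apply, Matrix.sub_apply, Matrix.smul_apply]
  refine Finset.sum_eq_zero fun a _ => Finset.sum_eq_zero fun b _ => ?_
  rw [mul_upper (part_upper hX a) (part_upper hY b) i j h,
    mul_upper (part_upper hY b) (part_upper hX a) i j h]
  simp

/-- `𝒫` is a graded subspace. -/
theorem part_mem_parabolic {m n : ℕ} (a : ZMod 2) {X : osp m n} (hX : X ∈ parabolic m n) :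
    (⟨part a X.1, isOsp_part a X.2⟩ : osp m n) ∈ parabolic m n := by
  rw [mem_parabolic_iff] at hX ⊢
  exact part_upper hX a

/-- The functional vanishes on superbrackets of elements of `𝒫`. -/
theorem vacuumFunctional_bracket {m n : ℕ} (p : ℂ) {X Y : osp m n} (hX : X ∈ parabolic m n)
    (hY : Y ∈ parabolic m n) : vacuumFunctional p (bracket X Y) = 0 := by
  rw [mem_parabolic_iff] at hX hY
  have hmul : ∀ {A B : SMat m n}, (∀ i j, level j < level i → A i j = 0) →
      (∀ i j, level j < level i → B i j = 0) → ∀ s : Fin (m + n),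
      (A * B) (top s) (top s) = ∑ t, A (top s) (top t) * B (top t) (top s) := by
    intro A B hA hB s
    rw [Matrix.mul_apply, sum_idx, hA (top s) mid (by simp [level_top, level_mid])]
    simp [fun t => hA (top s) (bot t) (by simp [level_top, level_bot])]
  have hab : ∀ a b : ZMod 2, ∑ s, lowestWeight p s *
      (part a X.1 * part b Y.1 - superSign a b • (part b Y.1 * part a X.1)) (top s) (top s) = 0 := by
    intro a b
    simp only [Matrix.sub_apply, Matrix.smul_apply, smul_eq_mul,
      hmul (part_upper hX a) (part_upper hY b), hmul (part_upper hY b) (part_upper hX a),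
      mul_sub, Finset.sum_sub_distrib, Finset.mul_sum]
    rw [sub_eq_zero, Finset.sum_comm]
    refine Finset.sum_congr rfl fun s _ => Finset.sum_congr rfl fun t _ => ?_
    simp only [part_apply, par_top]
    have hd : ∀ s : Fin (m + n), (deg s = 0 ∧ lowestWeight p s = -(p / 2)) ∨
        (deg s = 1 ∧ lowestWeight p s = p / 2) := by
      intro s
      unfold deg lowestWeight
      split_ifs <;> simp
    have h11 : (1 : ZMod 2) + 1 = 0 := by decide
    obtain rfl | rfl : a = 0 ∨ a = 1 := by revert a; decide
    all_goals obtain rfl | rfl : b = 0 ∨ b = 1 := by revert b; decide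
    all_goals obtain ⟨h1, h2⟩ | ⟨h1, h2⟩ := hd s
    all_goals obtain ⟨h3, h4⟩ | ⟨h3, h4⟩ := hd t
    all_goals simp [h1, h2, h3, h4, superSign, h11]
    all_goals (left; ring)
  change ∑ s, lowestWeight p s * superBracket X.1 Y.1 (top s) (top s) = 0
  simp only [superBracket, Matrix.sum_apply, Finset.mul_sum]
  rw [Finset.sum_comm]
  refine Finset.sum_eq_zero fun a _ => ?_
  rw [Finset.sum_comm]
  exact Finset.sum_eq_zero fun b _ => hab a b

/-- The functional vanishes on odd elements. -/
theorem vacuumFunctional_odd {m n : ℕ} (p : ℂ) {X : osp m n} (hX : IsHomogeneous 1 X.1) :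
    vacuumFunctional p X = 0 := by
  rw [vacuumFunctional_apply]
  refine Finset.sum_eq_zero fun s _ => ?_
  rw [(isHomogeneous_iff _ _).1 hX _ _, mul_zero]
  rw [par_top]
  generalize deg s = d
  revert d
  decide

/-- The functional defines a one-dimensional `𝒫`-module. -/
theorem vacuumFunctional_isCharacter {m n : ℕ} (p : ℂ) {a b : ZMod 2} {X Y : osp m n}
    (hX : X ∈ parabolic m n) (hY : Y ∈ parabolic m n) (ha : IsHomogeneous a X.1)
    (hb : IsHomogeneous b Y.1) :
    vacuumFunctional p (bracket X Y) = vacuumFunctional p X * vacuumFunctional p Y -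
      superSign a b * (vacuumFunctional p Y * vacuumFunctional p X) := by
  rw [vacuumFunctional_bracket p hX hY]
  by_cases h : a = 1 ∧ b = 1
  · obtain ⟨rfl, rfl⟩ := h
    simp [vacuumFunctional_odd p ha]
  · rw [superSign, if_neg h]
    ring

theorem vacuumFunctional_cMinus {m n : ℕ} (p : ℂ) (j : Fin (m + n)) :
    vacuumFunctional p (cMinus j) = 0 := by
  rw [vacuumFunctional_apply]
  refine Finset.sum_eq_zero fun s _ => ?_
  simp [cMinus, (top_ne_mid _).symm]

theorem vacuumFunctional_cMinus_cPlus {m n : ℕ} (p : ℂ) (j k : Fin (m + n)) :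
    vacuumFunctional p (bracket (cMinus j) (cPlus k)) = if j = k then p else 0 := by
  rw [bracket_cMinus_cPlus, map_neg, map_smul]
  have : vacuumFunctional p (bracket (cPlus k) (cMinus j)) =
      if j = k then 2 * lowestWeight p j else 0 := by
    simp only [vacuumFunctional, LinearMap.coe_mk, AddHom.coe_mk, bracket_cPlus_cMinus]
    simp [Matrix.single_apply, top_inj, (top_ne_bot _ _).symm, ite_and]
    split_ifs <;> simp_all [mul_comm]
  rw [this]
  split_ifs with h
  · subst h
    unfold lowestWeight deg superSign
    split_ifs <;> simp_all <;> ring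
  · simp

theorem vacuumFunctional_cMinus_cMinus {m n : ℕ} (p : ℂ) (j k : Fin (m + n)) :
    vacuumFunctional p (bracket (cMinus j) (cMinus k)) = 0 := by
  rw [vacuumFunctional_apply]
  refine Finset.sum_eq_zero fun s _ => ?_
  simp [bracket_cMinus_cMinus, (top_ne_bot _ _).symm]

/-! ### The enveloping algebra and induced modules -/

/-- The relations `XY - (-1)^{ab} YX = ⟦X, Y⟧` for homogeneous `X`, `Y` of parities `a`, `b`. -/
inductive EnvRel (m n : ℕ) :
    TensorAlgebra ℂ (osp m n) → TensorAlgebra ℂ (osp m n) → Prop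
  | supercomm (a b : ZMod 2) (X Y : osp m n) (hX : IsHomogeneous a X.1)
      (hY : IsHomogeneous b Y.1) :
      EnvRel m n
        (TensorAlgebra.ι ℂ X * TensorAlgebra.ι ℂ Y -
          superSign a b • (TensorAlgebra.ι ℂ Y * TensorAlgebra.ι ℂ X))
        (TensorAlgebra.ι ℂ (bracket X Y))

/-- The universal enveloping algebra of the Lie superalgebra `osp(2m+1|2n)`. -/
def Env (m n : ℕ) : Type := RingQuot (EnvRel m n)

instance (m n : ℕ) : Ring (Env m n) := inferInstanceAs (Ring (RingQuot (EnvRel m n)))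

instance (m n : ℕ) : Algebra ℂ (Env m n) :=
  inferInstanceAs (Algebra ℂ (RingQuot (EnvRel m n)))

/-- The canonical map from `osp(2m+1|2n)` to its enveloping algebra. -/
def toEnv {m n : ℕ} : osp m n →ₗ[ℂ] Env m n :=
  (RingQuot.mkAlgHom ℂ (EnvRel m n)).toLinearMap ∘ₗ TensorAlgebra.ι ℂ

/-- The `U(osp)`-submodule of `U(osp) ⊗ W` generated by the elements `uX ⊗ w - u ⊗ Xw`,
`X ∈ 𝔭`. -/
def inducedRel {m n : ℕ} (𝔭 : Submodule ℂ (osp m n)) {W : Type} [AddCommGroup W] [Module ℂ W]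
    (ρ : 𝔭 →ₗ[ℂ] Module.End ℂ W) : Submodule (Env m n) (Env m n ⊗[ℂ] W) :=
  Submodule.span (Env m n)
    {t | ∃ (u : Env m n) (X : 𝔭) (w : W), t = (u * toEnv X.1) ⊗ₜ[ℂ] w - u ⊗ₜ[ℂ] (ρ X w)}

/-- The induced module `U(osp) ⊗_{U(𝔭)} W` of a `𝔭`-module `W`: since `𝔭` generates `U(𝔭)`, it is
the quotient of `U(osp) ⊗_ℂ W` by the relations `uX ⊗ w = u ⊗ Xw` with `X ∈ 𝔭`. -/
abbrev Induced {m n : ℕ} (𝔭 : Submodule ℂ (osp m n)) {W : Type} [AddCommGroup W] [Module ℂ W]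
    (ρ : 𝔭 →ₗ[ℂ] Module.End ℂ W) : Type :=
  (Env m n ⊗[ℂ] W) ⧸ inducedRel 𝔭 ρ

/-- The action of `𝒫` on the one-dimensional space `ℂ|0⟩`. -/
def vacuumAction (m n : ℕ) (p : ℂ) : parabolic m n →ₗ[ℂ] Module.End ℂ ℂ :=
  LinearMap.toSpanSingleton ℂ (Module.End ℂ ℂ) 1 ∘ₗ vacuumFunctional p ∘ₗ (parabolic m n).subtype

/-- `V̄(p)`, the module induced from the `𝒫`-module `ℂ|0⟩`. -/
abbrev VBar (m n : ℕ) (p : ℂ) : Type := Induced (parabolic m n) (vacuumAction m n p)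

/-- The vacuum vector `|0⟩` of `V̄(p)`. -/
def vacuum (m n : ℕ) (p : ℂ) : VBar m n p :=
  Submodule.Quotient.mk ((1 : Env m n) ⊗ₜ[ℂ] (1 : ℂ))

theorem smul_vacuum {m n : ℕ} (p : ℂ) {X : osp m n} (hX : X ∈ parabolic m n) :
    toEnv X • vacuum m n p = vacuumFunctional p X • vacuum m n p := by
  change Submodule.Quotient.mk _ = Submodule.Quotient.mk _
  rw [Submodule.Quotient.eq]
  refine Submodule.subset_span ⟨1, ⟨X, hX⟩, 1, ?_⟩
  change toEnv X • ((1 : Env m n) ⊗ₜ[ℂ] (1 : ℂ)) -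
    vacuumFunctional p X • ((1 : Env m n) ⊗ₜ[ℂ] (1 : ℂ)) = _
  rw [TensorProduct.smul_tmul', TensorProduct.smul_tmul',
    TensorProduct.smul_tmul (vacuumFunctional p X)]
  simp [vacuumAction]

/-! ### The PBW vectors -/

/-- The pairs `j < k`. -/
abbrev Pair (r : ℕ) : Type := {q : Fin r × Fin r // q.1 < q.2}

/-- The pairs `j < k` in lexicographic order. -/
def pairList (r : ℕ) : List (Pair r) :=
  (List.finRange r).flatMap fun j =>
    (List.finRange r).filterMap fun k => if h : j < k then some ⟨(j, k), h⟩ else none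

/-- The exponents `k_j` and `k_{jk}` (`j < k`), where `k_{jk} ∈ {0, 1}` if `⟦c_j^+, c_k^+⟧` is
odd. -/
structure Exponents (m n : ℕ) where
  single : Fin (m + n) → ℕ
  pair : Pair (m + n) → ℕ
  pair_le : ∀ q : Pair (m + n), deg q.1.1 + deg q.1.2 = 1 → pair q ≤ 1

/-- `(c_1^+)^{k_1} ⋯ (c_{m+n}^+)^{k_{m+n}} ⟦c_1^+, c_2^+⟧^{k_{12}} ⟦c_1^+, c_3^+⟧^{k_{13}} ⋯
⟦c_{m+n-1}^+, c_{m+n}^+⟧^{k_{m+n-1,m+n}} |0⟩`. -/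
def pbwVector {m n : ℕ} (p : ℂ) (k : Exponents m n) : VBar m n p :=
  (((List.finRange (m + n)).map fun j => toEnv (cPlus j) ^ k.single j).prod *
    ((pairList (m + n)).map fun q =>
      toEnv (bracket (cPlus q.1.1) (cPlus q.1.2)) ^ k.pair q).prod) • vacuum m n p

/-! ### Characters -/

/-- The weight space of weight `μ`, where `μ j` is the eigenvalue of `h_j`. -/
def weightSpace {m n : ℕ} (V : Type) [AddCommGroup V] [Module ℂ V] [Module (Env m n) V]
    [IsScalarTower ℂ (Env m n) V] (μ : Fin (m + n) → ℂ) : Submodule ℂ V :=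
  ⨅ j, Module.End.eigenspace (Algebra.lsmul ℂ ℂ V (toEnv (cartan j : osp m n))) (μ j)

/-- The formal character: the coefficient of `x₁^{μ 1} ⋯ x_m^{μ m} y₁^{μ (m+1)} ⋯ y_n^{μ (m+n)}`
is the dimension of the weight space of weight `μ`. -/
def character {m n : ℕ} (V : Type) [AddCommGroup V] [Module ℂ V] [Module (Env m n) V]
    [IsScalarTower ℂ (Env m n) V] (μ : Fin (m + n) → ℂ) : ℚ :=
  Module.finrank ℂ (weightSpace (m := m) (n := n) V μ)

/-- The coefficients of the formal series
`x₁^{ν 1} ⋯ x_m^{ν m} y₁^{ν (m+1)} ⋯ y_n^{ν (m+n)} F(x, y)` with `F` a power series. -/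
def monomialMul {r : ℕ} (ν : Fin r → ℂ) (F : MvPowerSeries (Fin r) ℚ) (μ : Fin r → ℂ) : ℚ :=
  Function.extend (fun (k : Fin r →₀ ℕ) (j : Fin r) => ν j + (k j : ℂ))
    (fun k => MvPowerSeries.coeff k F) 0 μ

/-- The variable `x_i`. -/
def x {m n : ℕ} (i : Fin m) : MvPowerSeries (Fin (m + n)) ℚ := MvPowerSeries.X (Fin.castAdd n i)

/-- The variable `y_j`. -/
def y {m n : ℕ} (j : Fin n) : MvPowerSeries (Fin (m + n)) ℚ := MvPowerSeries.X (Fin.natAdd m j)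

/-- `∏_{i,j} (1 + x_i y_j)`. -/
def numerator (m n : ℕ) : MvPowerSeries (Fin (m + n)) ℚ :=
  ∏ i : Fin m, ∏ j : Fin n, (1 + x i * y j)

/-- `∏_i (1 - x_i) ∏_{i<k} (1 - x_i x_k) ∏_j (1 - y_j) ∏_{j<l} (1 - y_j y_l)`. -/
def denominator (m n : ℕ) : MvPowerSeries (Fin (m + n)) ℚ :=
  (∏ i : Fin m, (1 - x i)) * (∏ i : Fin m, ∏ k ∈ Finset.Ioi i, (1 - x i * x k)) *
    (∏ j : Fin n, (1 - y j)) * (∏ j : Fin n, ∏ l ∈ Finset.Ioi j, (1 - y j * y l))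

end Osp

end

/-! As a vector space, `osp m n` is the direct sum of `parabolic m n` and the span of the raising
elements: the c_j^+, the squares of the odd c_j^+, and the brackets of c_j^+ and c_k^+ with j < k.
By the Poincaré–Birkhoff–Witt theorem, the ordered words in a homogeneous basis adapted to this
splitting, raising letters first and odd letters at most once, form a basis of the enveloping
algebra. Inducing a one-dimensional module turns the parabolic part of each word into a scalar, and
one basis vector per raising word remains. For odd c = c_j^+ the letters c (at most once) and c²
(any number of times) together give every power of c exactly once, so k_j is unrestricted for odd j
too.

The spanning half of PBW is straightening (`span_wordProd_eq_top`). The independence half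
(`linearIndependent_wordProd`) compares leading terms by means of operators D_i that act on words,
modulo shorter words, as the superderivation dual to the i-th basis element. These operators come
from the coproduct X ↦ X ⊗ 1 + (-1)^{deg X} ⊗ X whose first factor acts on supermatrices: one
contracts that factor with a functional ξ satisfying ξ(1) = 0 and ξ(e_j) = δ_ij
(`exists_isWordDer`). Such a ξ exists because the identity matrix is not in `osp m n`.

To see that the PBW vectors stay independent in the quotient, `vacuumProj` sends a raising word
times a parabolic word to the corresponding multiple of a free generator. It kills the relations of
the induced module because the vacuum functional is a character of the parabolic (`vacuumProj_word`,
`vacuumProj_eq_zero`).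

For the character, each basis vector is a joint eigenvector of the h_j, with weight the lowest
weight plus its degree in x and y. Weight multiplicities therefore count exponents of given degree.
Their generating function is a product of geometric series 1/(1 - x^v) for the even pairs and all
the c_j^+, and of factors 1 + x_i y_j for the odd pairs. -/

open scoped TensorProduct Matrix

noncomputable section

namespace Osp

/-! ### Words in supercommuting elements up to shorter words -/

section Words

variable {A : Type*} [Ring A] {ι : Type*} (x : ι → A)

/-- The product of a word in the elements `x i`. -/
def wordProd (w : List ι) : A := (w.map x).prod

variable {x}

@[simp] theorem wordProd_nil : wordProd x [] = 1 := rfl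

@[simp] theorem wordProd_cons (i : ι) (w : List ι) : wordProd x (i :: w) = x i * wordProd x w := by
  simp [wordProd]

theorem wordProd_append (v w : List ι) : wordProd x (v ++ w) = wordProd x v * wordProd x w := by
  simp [wordProd]

variable [Algebra ℂ A]

variable (x) in
/-- The span of the products of the words of length less than `k`. -/
def shortWords (k : ℕ) : Submodule ℂ A :=
  Submodule.span ℂ {u | ∃ w : List ι, w.length < k ∧ wordProd x w = u}

theorem wordProd_mem_shortWords {w : List ι} {k : ℕ} (h : w.length < k) :
    wordProd x w ∈ shortWords x k := Submodule.subset_span ⟨w, h, rfl⟩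

theorem shortWords_mono : Monotone (shortWords x) := fun _ _ h =>
  Submodule.span_mono fun _ ⟨w, hw, e⟩ => ⟨w, hw.trans_le h, e⟩

theorem shortWords_zero : shortWords x 0 = ⊥ := by simp [shortWords]

theorem mul_mem_shortWords (i : ι) {k : ℕ} {u : A} (hu : u ∈ shortWords x k) :
    x i * u ∈ shortWords x (k + 1) := by
  induction hu using Submodule.span_induction with
  | zero => simp
  | add u v _ _ hu hv => rw [mul_add]; exact add_mem hu hv
  | smul r u _ hu => rw [mul_smul_comm]; exact Submodule.smul_mem _ _ hu
  | mem u hu =>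
    obtain ⟨w, hw, rfl⟩ := hu
    exact Submodule.subset_span ⟨i :: w, by simpa using hw, by simp⟩

/-- The bound `w.length + 2` is the length of a word with two letters in front of `w`: replacing a
product of two letters by a linear expression yields shorter words. -/
theorem mul_wordProd_mem_shortWords {u : A} (hu : u ∈ Submodule.span ℂ (Set.range x))
    (w : List ι) : u * wordProd x w ∈ shortWords x (w.length + 2) := by
  induction hu using Submodule.span_induction with
  | zero => simp
  | add u v _ _ hu hv => rw [add_mul]; exact add_mem hu hv
  | smul r u _ hu => rw [smul_mul_assoc]; exact Submodule.smul_mem _ _ hu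
  | mem u hu =>
    obtain ⟨i, rfl⟩ := hu
    exact Submodule.subset_span ⟨i :: w, by simp, by simp⟩

variable (x) in
/-- The elements `x i` of parity `d i` span a subspace closed under the supercommutator. -/
def SpansSuperalgebra (d : ι → ZMod 2) : Prop :=
  ∀ i j, x i * x j - superSign (d i) (d j) • (x j * x i) ∈ Submodule.span ℂ (Set.range x)

variable {d : ι → ZMod 2}

theorem superSign_ne_zero (a b : ZMod 2) : superSign a b ≠ 0 := by
  obtain h | h := superSign_cases a b <;> simp [h]

/-- Swapping adjacent letters costs a sign and a supercommutator, which is linear in the letters.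
Hence, modulo shorter words, a product depends on the order of its letters only through a nonzero
scalar. -/
theorem exists_sub_smul_mem_shortWords (hx : SpansSuperalgebra x d) {v w : List ι}
    (h : v.Perm w) :
    ∃ c : ℂ, c ≠ 0 ∧ wordProd x v - c • wordProd x w ∈ shortWords x v.length := by
  induction h with
  | nil => exact ⟨1, one_ne_zero, by simp⟩
  | @cons i v w _ ih =>
    obtain ⟨c, hc, h⟩ := ih
    refine ⟨c, hc, ?_⟩
    simpa [mul_sub] using mul_mem_shortWords i h
  | swap i j w =>
    refine ⟨superSign (d j) (d i), superSign_ne_zero _ _, ?_⟩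
    simpa [sub_mul, mul_assoc] using mul_wordProd_mem_shortWords (hx j i) w
  | @trans u v w huv _ ih₁ ih₂ =>
    obtain ⟨c, hc, h⟩ := ih₁
    obtain ⟨e, he, g⟩ := ih₂
    refine ⟨c * e, mul_ne_zero hc he, ?_⟩
    rw [← huv.length_eq] at g
    convert add_mem h (Submodule.smul_mem _ c g) using 1
    module

/-- The supercommutator of an odd element with itself is twice its square. -/
theorem sq_mem_span (hx : SpansSuperalgebra x d) {i : ι} (hi : d i = 1) :
    x i * x i ∈ Submodule.span ℂ (Set.range x) := by
  have h := Submodule.smul_mem _ (1 / 2 : ℂ) (hx i i)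
  rw [hi] at h
  convert h using 1
  simp only [superSign, and_self, if_true]
  module

variable [DecidableEq ι]

variable (d) in
/-- Elements of odd degree occur at most once. -/
def IsSuperMultiset (s : Multiset ι) : Prop := ∀ i, d i = 1 → s.count i ≤ 1

/-- Straightening, by induction on the length: an admissible word can be reordered modulo shorter
words, and an inadmissible one contains an odd letter twice, whose square is linear, so it is itself
a combination of shorter words. -/
theorem wordProd_mem_span (hx : SpansSuperalgebra x d) {J : Type*} {l : J → List ι}
    (hl : ∀ s, IsSuperMultiset d s → ∃ j, (l j : Multiset ι) = s) (w : List ι) :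
    wordProd x w ∈ Submodule.span ℂ (Set.range fun j => wordProd x (l j)) := by
  induction hn : w.length using Nat.strong_induction_on generalizing w with
  | _ n ih =>
    have hle : shortWords x n ≤ Submodule.span ℂ (Set.range fun j => wordProd x (l j)) := by
      refine Submodule.span_le.2 ?_
      rintro _ ⟨v, hv, rfl⟩
      exact ih _ hv v rfl
    by_cases hw : IsSuperMultiset d (w : Multiset ι)
    · obtain ⟨j, hj⟩ := hl _ hw
      obtain ⟨c, -, hc⟩ := exists_sub_smul_mem_shortWords hx (Multiset.coe_eq_coe.1 hj.symm)
      rw [hn] at hc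
      have := add_mem (hle hc)
        (Submodule.smul_mem _ c (Submodule.subset_span (Set.mem_range_self j)))
      simpa using this
    · obtain ⟨i, hi, h2⟩ : ∃ i, d i = 1 ∧ 1 < w.count i := by
        simpa [IsSuperMultiset] using hw
      -- Two copies of the repeated odd letter are moved to the front, where their product becomes
      -- linear.
      obtain ⟨v, hv⟩ : ∃ v, w.Perm (i :: i :: v) := by
        have h1 : i ∈ w := List.count_pos_iff.1 (by omega)
        have h3 : i ∈ w.erase i := List.count_pos_iff.1 (by rw [List.count_erase_self]; omega)
        exact ⟨_, (List.perm_cons_erase h1).trans ((List.perm_cons_erase h3).cons i)⟩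
      obtain ⟨c, -, hc⟩ := exists_sub_smul_mem_shortWords hx hv
      have h4 := mul_wordProd_mem_shortWords (sq_mem_span hx hi) v
      have h5 : v.length + 2 = n := by rw [← hn, hv.length_eq]; simp
      rw [h5] at h4
      rw [hn] at hc
      have := add_mem (hle hc) (Submodule.smul_mem _ c (hle h4))
      simpa [mul_assoc] using this

theorem span_wordProd_eq_top (hx : SpansSuperalgebra x d)
    (hadj : Algebra.adjoin ℂ (Set.range x) = ⊤) {J : Type*} {l : J → List ι}
    (hl : ∀ s, IsSuperMultiset d s → ∃ j, (l j : Multiset ι) = s) :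
    Submodule.span ℂ (Set.range fun j => wordProd x (l j)) = ⊤ := by
  rw [Submodule.eq_top_iff']
  intro u
  have hu : u ∈ Submodule.span ℂ (Submonoid.closure (Set.range x) : Set A) := by
    rw [← Algebra.adjoin_eq_span, hadj]
    trivial
  refine Submodule.span_le.2 ?_ hu
  intro u hu
  obtain ⟨L, hL, rfl⟩ := Submonoid.exists_list_of_mem_closure hu
  obtain ⟨w, rfl⟩ : ∃ w : List ι, w.map x = L := by
    rwa [← Set.mem_range, Set.range_list_map]
  exact wordProd_mem_span hx hl w

/-! ### Superderivations and linear independence of words -/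

variable (x d) in
/-- The superderivation of words with `x j ↦ δ_{ij}`. -/
def wordDer (i : ι) : List ι → A
  | [] => 0
  | j :: w => (if j = i then wordProd x w else 0) +
      superSign (d i) (d j) • (x j * wordDer i w)

theorem wordDer_mem (i : ι) (w : List ι) : wordDer x d i w ∈ shortWords x w.length := by
  induction w with
  | nil => simp [wordDer]
  | cons j w ih =>
    rw [wordDer]
    refine add_mem ?_ (Submodule.smul_mem _ _ (mul_mem_shortWords j ih))
    split_ifs
    · exact wordProd_mem_shortWords (by simp)
    · exact zero_mem _

theorem wordDer_of_notMem {i : ι} {w : List ι} (h : i ∉ w) : wordDer x d i w = 0 := by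
  induction w with
  | nil => rfl
  | cons j w ih =>
    simp only [List.mem_cons, not_or] at h
    simp [wordDer, ih h.2, Ne.symm h.1]

/-- This is the rule ∂(x^c) = c x^(c-1). For even `i` no signs arise; for odd `i` they would
alternate, but then `c ≤ 1`. -/
theorem wordDer_replicate {i : ι} {w : List ι} (h : i ∉ w) {c : ℕ} (hc : d i = 1 → c ≤ 1) :
    wordDer x d i (List.replicate c i ++ w) =
      (c : ℂ) • wordProd x (List.replicate (c - 1) i ++ w) := by
  induction c with
  | zero => simp [wordDer_of_notMem h]
  | succ c ih =>
    rw [List.replicate_succ, List.cons_append, wordDer, if_pos rfl,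
      ih fun hi => (Nat.le_succ c).trans (hc hi)]
    cases c with
    | zero => simp
    | succ c =>
      have hi : d i ≠ 1 := fun hi => by have := hc hi; omega
      simp only [superSign, hi, false_and, if_false, one_smul, Nat.add_sub_cancel,
        List.replicate_succ, List.cons_append, wordProd_cons, mul_smul_comm]
      push_cast
      module

variable (x d) in
/-- `D` is, up to shorter words, the superderivation with `x j ↦ δ_{ij}`. -/
def IsWordDer (i : ι) (D : A →ₗ[ℂ] A) : Prop :=
  ∀ w : List ι, D (wordProd x w) - wordDer x d i w ∈ shortWords x (w.length - 1)

/-- Such an operator lowers the length filtration by one, so it can be applied to congruences modulo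
shorter words. -/
theorem IsWordDer.map_mem {i : ι} {D : A →ₗ[ℂ] A} (hD : IsWordDer x d i D) {k : ℕ} {u : A}
    (hu : u ∈ shortWords x (k + 1)) : D u ∈ shortWords x k := by
  induction hu using Submodule.span_induction with
  | zero => simp
  | add u v _ _ hu hv => rw [map_add]; exact add_mem hu hv
  | smul r u _ hu => rw [map_smul]; exact Submodule.smul_mem _ _ hu
  | mem u hu =>
    obtain ⟨w, hw, rfl⟩ := hu
    have h := add_mem (shortWords_mono (by omega : w.length - 1 ≤ k) (hD w))
      (shortWords_mono (by omega : w.length ≤ k) (wordDer_mem (d := d) (x := x) i w))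
    simpa using h

/-- The leading part of a relation behaves like a superpolynomial, and a superpolynomial all of
whose derivatives vanish has no term of positive degree. The induction on `n` applies D_i for a
letter `i` of the given multiset. The choice `l` of orderings is quantified inside the induction
because it changes at each step. -/
theorem coeff_eq_zero_of_sum_mem_shortWords [Nontrivial A] (hx : SpansSuperalgebra x d)
    {D : ι → A →ₗ[ℂ] A} (hD : ∀ i, IsWordDer x d i (D i)) (n : ℕ) :
    ∀ (l : Multiset ι → List ι), (∀ s, (l s : Multiset ι) = s) →
    ∀ (S : Finset (Multiset ι)) (a : Multiset ι → ℂ), (∀ s ∈ S, IsSuperMultiset d s) →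
    (∀ s ∈ S, s.card ≤ n) → ∑ s ∈ S, a s • wordProd x (l s) ∈ shortWords x n →
    ∀ s ∈ S, s.card = n → a s = 0 := by
  induction n with
  | zero =>
    intro l hl S a _ hcard hsum s hs hs0
    have hz : ∀ t ∈ S, t = 0 := fun t ht => Multiset.card_eq_zero.1 (Nat.le_zero.1 (hcard t ht))
    have hS : S = {0} := Finset.eq_singleton_iff_unique_mem.2 ⟨hz s hs ▸ hs, hz⟩
    have hl0 : l 0 = [] := by simpa using hl 0
    rw [hS, Finset.sum_singleton, hl0, shortWords_zero, Submodule.mem_bot] at hsum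
    rw [hz s hs]
    simpa using hsum
  | succ n ih =>
    intro l hl S a hgood hcard hsum s hs hsn
    obtain ⟨i, hi⟩ : ∃ i, i ∈ s := Multiset.card_pos_iff_exists_mem.1 (by omega)
    -- This ordering puts all copies of `i` in front, the shape required by `wordDer_replicate`.
    -- Passing to it from `l` multiplies each coefficient by some nonzero `c t`, modulo shorter
    -- words.
    let r : Multiset ι → List ι := fun t =>
      List.replicate (t.count i) i ++ (t.filter (· ≠ i)).toList
    have hr : ∀ t, (r t : Multiset ι) = t := by
      intro t
      simp only [r, ← Multiset.coe_add, Multiset.coe_toList, Multiset.coe_replicate]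
      rw [← Multiset.filter_eq', Multiset.filter_add_not]
    have hperm : ∀ t, ∃ c : ℂ, c ≠ 0 ∧
        wordProd x (l t) - c • wordProd x (r t) ∈ shortWords x t.card := by
      intro t
      obtain ⟨c, hc, h⟩ := exists_sub_smul_mem_shortWords hx
        (Multiset.coe_eq_coe.1 ((hl t).trans (hr t).symm))
      refine ⟨c, hc, ?_⟩
      rwa [← Multiset.coe_card, hl] at h
    choose c hc hcw using hperm
    have h1 : ∑ t ∈ S, (a t * c t) • wordProd x (r t) ∈ shortWords x (n + 1) := by
      have h : ∑ t ∈ S, a t • (wordProd x (l t) - c t • wordProd x (r t)) ∈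
          shortWords x (n + 1) := sum_mem fun t ht =>
        Submodule.smul_mem _ _ (shortWords_mono (hcard t ht) (hcw t))
      convert sub_mem hsum h using 1
      rw [← Finset.sum_sub_distrib]
      exact Finset.sum_congr rfl fun t _ => by module
    have h2 : ∀ t ∈ S, D i (wordProd x (r t)) -
        (t.count i : ℂ) • wordProd x (r (t.erase i)) ∈ shortWords x n := by
      intro t ht
      have h := hD i (r t)
      rw [wordDer_replicate (by simp) (hgood t ht i)] at h
      have e : t.count i - 1 = (t.erase i).count i := by simp
      have e' : t.filter (· ≠ i) = (t.erase i).filter (· ≠ i) := by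
        ext j
        by_cases hj : j = i
        · simp [hj]
        · simp [hj]
      rw [e, e', ← Multiset.coe_card, hr] at h
      exact shortWords_mono (by have := hcard t ht; omega) h
    have h3 : ∑ t ∈ S, (a t * c t * t.count i) • wordProd x (r (t.erase i)) ∈
        shortWords x n := by
      have h := (hD i).map_mem h1
      rw [map_sum] at h
      have h' := sum_mem fun t ht => Submodule.smul_mem (shortWords x n) (a t * c t) (h2 t ht)
      convert sub_mem h h' using 1
      rw [← Finset.sum_sub_distrib]
      exact Finset.sum_congr rfl fun t _ => by rw [map_smul]; module
    -- Erasing `i` is injective only on multisets containing `i`. The others drop out of the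
    -- differentiated relation, since their coefficient carries the factor `t.count i = 0`.
    have hinj : Set.InjOn (fun t : Multiset ι => t.erase i)
        (S.filter (i ∈ ·) : Finset (Multiset ι)) := by
      intro t ht u hu h
      simp only [Finset.coe_filter, Set.mem_ofPred_eq] at ht hu
      rw [← Multiset.cons_erase ht.2, ← Multiset.cons_erase hu.2]
      exact congrArg _ h
    have h4 := ih r hr ((S.filter (i ∈ ·)).image fun t => t.erase i)
      (fun u => a (i ::ₘ u) * c (i ::ₘ u) * (i ::ₘ u).count i) ?_ ?_ ?_ (s.erase i)
      (Finset.mem_image_of_mem _ (Finset.mem_filter.2 ⟨hs, hi⟩))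
      (by rw [Multiset.card_erase_of_mem hi, hsn]; rfl)
    · simp only [Multiset.cons_erase hi] at h4
      have : (s.count i : ℂ) ≠ 0 := by
        exact_mod_cast (Multiset.count_pos.2 hi).ne'
      simpa [hc s, this] using h4
    · intro u hu j hj
      obtain ⟨t, ht, rfl⟩ := Finset.mem_image.1 hu
      exact (Multiset.count_le_of_le j (Multiset.erase_le i t)).trans
        (hgood t (Finset.mem_filter.1 ht).1 j hj)
    · intro u hu
      obtain ⟨t, ht, rfl⟩ := Finset.mem_image.1 hu
      rw [Finset.mem_filter] at ht
      have := hcard t ht.1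
      rw [Multiset.card_erase_of_mem ht.2]
      exact Nat.pred_le_iff.2 this
    · rw [Finset.sum_image hinj]
      convert h3 using 1
      rw [Finset.sum_filter]
      refine Finset.sum_congr rfl fun t _ => ?_
      split_ifs with h
      · rw [Multiset.cons_erase h]
      · simp [Multiset.count_eq_zero.2 h]

theorem linearIndependent_wordProd [Nontrivial A] (hx : SpansSuperalgebra x d)
    {D : ι → A →ₗ[ℂ] A} (hD : ∀ i, IsWordDer x d i (D i)) {J : Type*} {l : J → List ι}
    (hinj : Function.Injective fun j => (l j : Multiset ι))
    (hgood : ∀ j, IsSuperMultiset d (l j : Multiset ι)) :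
    LinearIndependent ℂ fun j => wordProd x (l j) := by
  classical
  rw [linearIndependent_iff']
  intro s g hg
  by_contra! hne
  -- A longest word with nonzero coefficient gives a leading term that contradicts the previous
  -- lemma.
  obtain ⟨j, hj, hmax⟩ := (s.filter (g · ≠ 0)).exists_max_image (fun j => (l j).length)
    (by obtain ⟨i, hi, h⟩ := hne; exact ⟨i, Finset.mem_filter.2 ⟨hi, h⟩⟩)
  set f : J → Multiset ι := fun j => (l j : Multiset ι) with hf
  -- The words are reindexed by their multisets. The default `Multiset.toList` keeps the chosen list
  -- an ordering of its multiset outside the range of `f`; the default coefficient 0 plays no role.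
  have key := coeff_eq_zero_of_sum_mem_shortWords hx hD (l j).length
    (Function.extend f l Multiset.toList) ?_ ((s.filter (g · ≠ 0)).image f)
    (Function.extend f g 0) ?_ ?_ ?_ (f j) (Finset.mem_image_of_mem _ hj) (by simp [hf])
  · rw [hinj.extend_apply] at key
    exact (Finset.mem_filter.1 hj).2 key
  · intro t
    by_cases ht : ∃ k, f k = t
    · obtain ⟨k, rfl⟩ := ht
      rw [hinj.extend_apply]
    · rw [Function.extend_apply' _ _ _ ht, Multiset.coe_toList]
  · intro t ht
    obtain ⟨k, -, rfl⟩ := Finset.mem_image.1 ht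
    exact hgood k
  · intro t ht
    obtain ⟨k, hk, rfl⟩ := Finset.mem_image.1 ht
    exact hmax k hk
  · rw [Finset.sum_image hinj.injOn, Finset.sum_filter]
    simp only [hinj.extend_apply]
    have h : ∑ k ∈ s, (if g k ≠ 0 then g k • wordProd x (l k) else 0) = 0 := by
      refine Eq.trans (Finset.sum_congr rfl fun k _ => ?_) hg
      split_ifs with h
      · rfl
      · simp [not_not.1 h]
    rw [h]
    exact zero_mem _

end Words

/-! ### The universal property of the enveloping algebra -/

section Env

variable {m n : ℕ}

theorem toEnv_supercomm {a b : ZMod 2} {X Y : osp m n} (hX : IsHomogeneous a X.1)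
    (hY : IsHomogeneous b Y.1) :
    toEnv X * toEnv Y - superSign a b • (toEnv Y * toEnv X) = toEnv (bracket X Y) := by
  have h := RingQuot.mkAlgHom_rel ℂ (EnvRel.supercomm a b X Y hX hY)
  rw [map_sub, map_smul, map_mul, map_mul] at h
  exact h

/-- The algebra homomorphism from the enveloping algebra defined by a representation. -/
def Env.lift {B : Type*} [Ring B] [Algebra ℂ B] (f : osp m n →ₗ[ℂ] B)
    (hf : ∀ (a b : ZMod 2) (X Y : osp m n), IsHomogeneous a X.1 → IsHomogeneous b Y.1 →
      f X * f Y - superSign a b • (f Y * f X) = f (bracket X Y)) : Env m n →ₐ[ℂ] B :=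
  RingQuot.liftAlgHom ℂ ⟨TensorAlgebra.lift ℂ f, by
    rintro _ _ ⟨a, b, X, Y, hX, hY⟩
    simpa using hf a b X Y hX hY⟩

theorem Env.lift_toEnv {B : Type*} [Ring B] [Algebra ℂ B] (f : osp m n →ₗ[ℂ] B)
    (hf : ∀ (a b : ZMod 2) (X Y : osp m n), IsHomogeneous a X.1 → IsHomogeneous b Y.1 →
      f X * f Y - superSign a b • (f Y * f X) = f (bracket X Y)) (X : osp m n) :
    Env.lift f hf (toEnv X) = f X := by
  have h := RingQuot.liftAlgHom_mkAlgHom_apply ℂ (TensorAlgebra.lift ℂ f) (s := EnvRel m n)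
    (by rintro _ _ ⟨a, b, X, Y, hX, hY⟩; simpa using hf a b X Y hX hY) (TensorAlgebra.ι ℂ X)
  rw [TensorAlgebra.lift_ι_apply] at h
  exact h

/-- The zero representation induces the augmentation, a ring homomorphism to the nontrivial ring ℂ.
-/
instance : Nontrivial (Env m n) :=
  (Env.lift (m := m) (n := n) (B := ℂ) 0 (by simp)).toRingHom.domain_nontrivial

theorem Env.induction {C : Env m n → Prop} (algebraMap : ∀ r : ℂ, C (algebraMap ℂ _ r))
    (toEnv : ∀ X, C (toEnv X)) (mul : ∀ u v, C u → C v → C (u * v))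
    (add : ∀ u v, C u → C v → C (u + v)) (u : Env m n) : C u := by
  obtain ⟨t, rfl⟩ := RingQuot.mkAlgHom_surjective ℂ (EnvRel m n) u
  induction t using TensorAlgebra.induction with
  | algebraMap r => rw [AlgHom.commutes]; exact algebraMap r
  | ι X => exact toEnv X
  | mul u v hu hv => rw [map_mul]; exact mul _ _ hu hv
  | add u v hu hv => rw [map_add]; exact add _ _ hu hv

/-! ### The coproduct -/

theorem superSign_add_right (a b c : ZMod 2) :
    superSign a (b + c) = superSign a b * superSign a c := by
  have h11 : (1 : ZMod 2) + 1 = 0 := by decide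
  obtain rfl | rfl : a = 0 ∨ a = 1 := by revert a; decide
  all_goals obtain rfl | rfl : b = 0 ∨ b = 1 := by revert b; decide
  all_goals obtain rfl | rfl : c = 0 ∨ c = 1 := by revert c; decide
  all_goals simp [superSign, h11]

theorem superSign_add_left (a b c : ZMod 2) :
    superSign (a + b) c = superSign a c * superSign b c := by
  rw [superSign_comm, superSign_add_right, superSign_comm c, superSign_comm c]

@[simp] theorem superSign_zero_right (a : ZMod 2) : superSign a 0 = 1 := by simp [superSign]

@[simp] theorem superSign_zero_left (a : ZMod 2) : superSign 0 a = 1 := by simp [superSign]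

/-- The operator `(-1)^{ab}` on supermatrices of parity `b`. -/
def signOp (a : ZMod 2) : Module.End ℂ (SMat m n) where
  toFun X := .of fun i j => superSign a (par i + par j) * X i j
  map_add' X Y := by ext i j; simp [mul_add]
  map_smul' r X := by ext i j; simp [mul_left_comm]

theorem signOp_apply (a : ZMod 2) (X : SMat m n) (i j : Idx m n) :
    signOp a X i j = superSign a (par i + par j) * X i j := rfl

theorem signOp_of_homogeneous (a : ZMod 2) {b : ZMod 2} {X : SMat m n}
    (hX : IsHomogeneous b X) : signOp a X = superSign a b • X := by
  ext i j
  rw [signOp_apply, Matrix.smul_apply, smul_eq_mul]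
  by_cases h : par i + par j = b
  · rw [h]
  · rw [(isHomogeneous_iff _ _).1 hX i j h, mul_zero, mul_zero]

theorem isHomogeneous_one : IsHomogeneous 0 (1 : SMat m n) := by
  rw [isHomogeneous_iff]
  intro i j h
  refine Matrix.one_apply_ne ?_
  rintro rfl
  exact h (CharTwo.add_self_eq_zero _)

theorem signOp_one (a : ZMod 2) : signOp a (1 : SMat m n) = 1 := by
  rw [signOp_of_homogeneous a isHomogeneous_one]; simp

theorem signOp_mul_signOp (a b : ZMod 2) :
    signOp a * signOp b = (signOp (a + b) : Module.End ℂ (SMat m n)) := by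
  ext1 X
  ext i j
  simp only [Module.End.mul_apply, signOp_apply, superSign_add_left, mul_assoc]

theorem lmul_SMat_apply (X Y : SMat m n) : Algebra.lmul ℂ (SMat m n) X Y = X * Y := rfl

/-- This commutation rule supplies the Koszul signs, so that the ordinary tensor product of algebras
can replace the super tensor product. -/
theorem signOp_mul_lmul (a : ZMod 2) {b : ZMod 2} {X : SMat m n} (hX : IsHomogeneous b X) :
    signOp a * Algebra.lmul ℂ _ X =
      superSign a b • (Algebra.lmul ℂ _ X * signOp a : Module.End ℂ (SMat m n)) := by
  ext1 Y
  ext i j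
  simp only [Module.End.mul_apply, lmul_SMat_apply, LinearMap.smul_apply,
    Matrix.smul_apply, signOp_apply, Matrix.mul_apply, smul_eq_mul, Finset.mul_sum]
  refine Finset.sum_congr rfl fun k _ => ?_
  by_cases h : par i + par k = b
  · have : par i + par j = b + (par k + par j) := by
      rw [← h]
      linear_combination -(CharTwo.add_self_eq_zero (par k))
    rw [this, superSign_add_right]
    ring
  · rw [(isHomogeneous_iff _ _).1 hX i k h]
    ring

/-- The component of parity `a` of an element of `osp(2m+1|2n)`. -/
def ospPart (a : ZMod 2) : osp m n →ₗ[ℂ] osp m n where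
  toFun X := ⟨part a X.1, isOsp_part a X.2⟩
  map_add' X Y := by
    ext i j
    simp only [part_apply, Submodule.coe_add, Matrix.add_apply]
    split_ifs <;> simp
  map_smul' r X := by
    ext i j
    simp only [part_apply, Submodule.coe_smul, Matrix.smul_apply, RingHom.id_apply]
    split_ifs <;> simp

theorem ospPart_of_homogeneous {a : ZMod 2} {X : osp m n} (hX : IsHomogeneous a X.1)
    (b : ZMod 2) : ospPart b X = if b = a then X else 0 := by
  apply Subtype.ext
  change part b X.1 = _
  rw [part_of_homogeneous hX]
  split_ifs <;> rfl

theorem IsHomogeneous.mul {a b : ZMod 2} {X Y : SMat m n} (hX : IsHomogeneous a X)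
    (hY : IsHomogeneous b Y) : IsHomogeneous (a + b) (X * Y) := by
  rw [isHomogeneous_iff] at *
  intro i j h
  rw [Matrix.mul_apply]
  refine Finset.sum_eq_zero fun k _ => ?_
  by_cases h1 : par i + par k = a
  · rw [hY k j fun h2 => h ?_, mul_zero]
    rw [← h1, ← h2]
    linear_combination -(CharTwo.add_self_eq_zero (par k))
  · rw [hX i k h1, zero_mul]

theorem isHomogeneous_bracket {a b : ZMod 2} {X Y : osp m n} (hX : IsHomogeneous a X.1)
    (hY : IsHomogeneous b Y.1) : IsHomogeneous (a + b) (bracket X Y).1 := by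
  change IsHomogeneous _ (superBracket X.1 Y.1)
  rw [superBracket_of_homogeneous hX hY, isHomogeneous_iff]
  intro i j h
  rw [Matrix.sub_apply, Matrix.smul_apply, (isHomogeneous_iff _ _).1 (hX.mul hY) i j h,
    (isHomogeneous_iff _ _).1 (hY.mul hX) i j (by rwa [add_comm b a])]
  simp

/-- The coproduct `X ↦ X ⊗ 1 + (-1)^{deg X} ⊗ X`, whose first factor acts on supermatrices. -/
def coprodLin : osp m n →ₗ[ℂ] Module.End ℂ (SMat m n) ⊗[ℂ] Env m n :=
  (TensorProduct.mk ℂ _ _).flip 1 ∘ₗ (Algebra.lmul ℂ (SMat m n)).toLinearMap ∘ₗ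
      (osp m n).subtype +
    ∑ a, TensorProduct.mk ℂ _ _ (signOp a) ∘ₗ toEnv ∘ₗ ospPart a

theorem coprodLin_of_homogeneous {a : ZMod 2} {X : osp m n} (hX : IsHomogeneous a X.1) :
    coprodLin X = Algebra.lmul ℂ (SMat m n) X.1 ⊗ₜ 1 + signOp a ⊗ₜ toEnv X := by
  simp [coprodLin, LinearMap.sum_apply, ospPart_of_homogeneous hX, apply_ite toEnv,
    TensorProduct.tmul_ite]

/-- The mixed terms cancel by `signOp_mul_lmul` and because the sign squares to 1; the two unmixed
terms reproduce the superbracket in each factor. -/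
theorem coprodLin_bracket (a b : ZMod 2) (X Y : osp m n) (hX : IsHomogeneous a X.1)
    (hY : IsHomogeneous b Y.1) :
    coprodLin X * coprodLin Y - superSign a b • (coprodLin Y * coprodLin X) =
      coprodLin (bracket X Y) := by
  rw [coprodLin_of_homogeneous hX, coprodLin_of_homogeneous hY,
    coprodLin_of_homogeneous (isHomogeneous_bracket hX hY), ← toEnv_supercomm hX hY]
  change _ = Algebra.lmul ℂ _ (superBracket X.1 Y.1) ⊗ₜ 1 + _
  rw [superBracket_of_homogeneous hX hY]
  simp only [mul_add, add_mul, Algebra.TensorProduct.tmul_mul_tmul, one_mul, mul_one,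
    signOp_mul_lmul a hY, signOp_mul_lmul b hX, signOp_mul_signOp, add_comm b a, map_sub, map_smul,
    map_mul, TensorProduct.sub_tmul, TensorProduct.tmul_sub, TensorProduct.tmul_smul,
    TensorProduct.smul_tmul', smul_add, superSign_comm b a, smul_smul, superSign_mul_self,
    one_smul]
  abel

/-- The coproduct of the enveloping algebra, with first factor acting on supermatrices. -/
def coprod : Env m n →ₐ[ℂ] Module.End ℂ (SMat m n) ⊗[ℂ] Env m n :=
  Env.lift (B := Module.End ℂ (SMat m n) ⊗[ℂ] Env m n) coprodLin coprodLin_bracket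

/-- The contraction of the first factor with the functional `T ↦ ξ (T 1)`. -/
def contract (ξ : SMat m n →ₗ[ℂ] ℂ) : Module.End ℂ (SMat m n) ⊗[ℂ] Env m n →ₗ[ℂ] Env m n :=
  (TensorProduct.lid ℂ (Env m n)).toLinearMap ∘ₗ TensorProduct.map (ξ ∘ₗ LinearMap.applyₗ 1) LinearMap.id

theorem contract_tmul (ξ : SMat m n →ₗ[ℂ] ℂ) (T : Module.End ℂ (SMat m n)) (u : Env m n) :
    contract ξ (T ⊗ₜ u) = ξ (T 1) • u := by
  simp [contract]

theorem contract_tmul_mul (ξ : SMat m n →ₗ[ℂ] ℂ) (T : Module.End ℂ (SMat m n)) (u : Env m n)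
    (t : Module.End ℂ (SMat m n) ⊗[ℂ] Env m n) :
    contract ξ (T ⊗ₜ u * t) = u * contract (ξ ∘ₗ T) t := by
  induction t with
  | zero => simp
  | add s t hs ht => rw [mul_add, map_add, map_add, mul_add, hs, ht]
  | tmul S v => simp [contract_tmul]

/-- The map `u ↦ ∑ ξ(u' 1) u''`, where `∑ u' ⊗ u''` is the coproduct of `u`. -/
def contractCoprod (ξ : SMat m n →ₗ[ℂ] ℂ) : Env m n →ₗ[ℂ] Env m n :=
  contract ξ ∘ₗ coprod.toLinearMap

theorem contractCoprod_one (ξ : SMat m n →ₗ[ℂ] ℂ) : contractCoprod ξ 1 = ξ 1 • 1 := by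
  change contract ξ (coprod 1) = _
  rw [show coprod (1 : Env m n) = 1 from coprod.map_one', Algebra.TensorProduct.one_def, contract_tmul]
  rfl

/-- Each letter either goes into the matrix factor, changing the functional, or stays outside and
leaves its sign operator in the functional. This is a recursion over words. -/
theorem contractCoprod_toEnv_mul (ξ : SMat m n →ₗ[ℂ] ℂ) {a : ZMod 2} {X : osp m n}
    (hX : IsHomogeneous a X.1) (u : Env m n) :
    contractCoprod ξ (toEnv X * u) = contractCoprod (ξ ∘ₗ Algebra.lmul ℂ _ X.1) u +
      toEnv X * contractCoprod (ξ ∘ₗ signOp a) u := by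
  change contract ξ (coprod (toEnv X * u)) = _
  rw [map_mul, coprod, Env.lift_toEnv, coprodLin_of_homogeneous hX, add_mul, map_add,
    contract_tmul_mul, contract_tmul_mul, one_mul]
  rfl

/-! ### The Poincaré–Birkhoff–Witt theorem -/

variable {ι : Type*}

theorem spansSuperalgebra_toEnv {d : ι → ZMod 2} {e : ι → osp m n}
    (he : Submodule.span ℂ (Set.range e) = ⊤) (hd : ∀ i, IsHomogeneous (d i) (e i).1) :
    SpansSuperalgebra (fun i => toEnv (e i)) d := by
  intro i j
  rw [toEnv_supercomm (hd i) (hd j)]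
  have h : bracket (e i) (e j) ∈ Submodule.span ℂ (Set.range e) := he ▸ Submodule.mem_top
  have := Submodule.mem_map_of_mem (f := toEnv) h
  rwa [Submodule.map_span, ← Set.range_comp] at this

/-- Expanding the coproduct of a word, the terms with no letter in the matrix factor give ξ(1) times
the word, those with one letter give the superderivations, and those with two or more letters are
too short to matter. All ξ are treated at once because the recursion changes ξ. -/
theorem contractCoprod_wordProd [Fintype ι] [DecidableEq ι] {d : ι → ZMod 2} {e : ι → osp m n}
    (hd : ∀ i, IsHomogeneous (d i) (e i).1) (w : List ι) :
    ∀ ξ : SMat m n →ₗ[ℂ] ℂ,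
    contractCoprod ξ (wordProd (fun i => toEnv (e i)) w) -
      (ξ 1 • wordProd (fun i => toEnv (e i)) w +
        ∑ j, ξ (e j).1 • wordDer (fun i => toEnv (e i)) d j w) ∈
      shortWords (fun i => toEnv (e i)) (w.length - 1) := by
  induction w with
  | nil => simp [contractCoprod_one, wordDer]
  | cons i w ih =>
    intro ξ
    rw [wordProd_cons, contractCoprod_toEnv_mul ξ (hd i)]
    have h1 := shortWords_mono (Nat.sub_le _ 1) (ih (ξ ∘ₗ Algebra.lmul ℂ _ (e i).1))
    -- The empty word is treated apart: because `0 - 1 = 0`, the general bound would be one too weak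
    -- there, but the error term is zero.
    have h2 : toEnv (e i) * (contractCoprod (ξ ∘ₗ signOp (d i))
        (wordProd (fun i => toEnv (e i)) w) -
          ((ξ ∘ₗ signOp (d i)) 1 • wordProd (fun i => toEnv (e i)) w +
            ∑ j, (ξ ∘ₗ signOp (d i)) (e j).1 • wordDer (fun i => toEnv (e i)) d j w)) ∈
        shortWords (fun i => toEnv (e i)) w.length := by
      cases w with
      | nil => simp [contractCoprod_one, wordDer]
      | cons j w =>
        exact mul_mem_shortWords (x := fun i => toEnv (e i)) i (ih (ξ ∘ₗ signOp (d i)))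
    -- Two letters have gone into the matrix factor here, so these terms can be discarded.
    have h3 : ∑ j, ξ ((e i).1 * (e j).1) • wordDer (fun i => toEnv (e i)) d j w ∈
        shortWords (fun i => toEnv (e i)) w.length :=
      sum_mem fun j _ => Submodule.smul_mem _ _ (wordDer_mem j w)
    have h := add_mem (add_mem h1 h2) h3
    rw [List.length_cons, Nat.add_sub_cancel]
    convert h using 1
    have e1 : (ξ ∘ₗ Algebra.lmul ℂ (SMat m n) (e i).1) 1 = ξ (e i).1 :=
      congrArg ξ (mul_one (e i).1)
    have e2 : ∀ j, (ξ ∘ₗ Algebra.lmul ℂ (SMat m n) (e i).1) (e j).1 = ξ ((e i).1 * (e j).1) :=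
      fun _ => rfl
    have e3 : (ξ ∘ₗ signOp (d i)) 1 = ξ 1 := congrArg ξ (signOp_one _)
    have e4 : ∀ j, (ξ ∘ₗ signOp (d i)) (e j).1 = ξ (e j).1 * superSign (d j) (d i) := by
      intro j
      rw [LinearMap.comp_apply, signOp_of_homogeneous _ (hd j), map_smul, smul_eq_mul, mul_comm,
        superSign_comm]
    simp only [e1, e2, e3, e4, wordDer, smul_add, Finset.sum_add_distrib, smul_ite, smul_zero,
      Finset.sum_ite_eq, Finset.mem_univ, if_true, smul_smul, mul_sub, mul_add, mul_smul_comm,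
      Finset.mul_sum]
    abel

/-- Together with the identity matrix the `e i` remain independent, so some functional takes the
value 1 at `e i` and vanishes at the identity and the other `e j`. Contracting the coproduct with it
leaves one superderivation as leading term. -/
theorem exists_isWordDer [Fintype ι] [DecidableEq ι] {d : ι → ZMod 2} {e : ι → osp m n}
    (hd : ∀ i, IsHomogeneous (d i) (e i).1) (he : LinearIndependent ℂ e)
    (hone : ∀ X : osp m n, X.1 ≠ 1) (i : ι) :
    ∃ D, IsWordDer (fun i => toEnv (e i)) d i D := by
  have h : LinearIndependent ℂ
      (fun o : Option ι => o.elim (1 : SMat m n) fun i => (e i).1) := by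
    rw [linearIndependent_option]
    refine ⟨he.map' (osp m n).subtype (Submodule.ker_subtype _), fun h => ?_⟩
    have : Submodule.span ℂ (Set.range fun i => (e i).1) ≤ osp m n :=
      Submodule.span_le.2 (by rintro _ ⟨i, rfl⟩; exact (e i).2)
    exact hone ⟨1, this h⟩ rfl
  -- The coordinate of `e i` is defined on the span of the identity and the `e j`; any linear
  -- extension to all supermatrices will do.
  obtain ⟨ξ, hξ⟩ := LinearMap.exists_extend ((Finsupp.lapply (R := ℂ) (M := ℂ) (some i)) ∘ₗ h.repr)
  have hval : ∀ o : Option ι, ξ (o.elim (1 : SMat m n) fun i => (e i).1) =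
      if o = some i then 1 else 0 := by
    intro o
    have h1 := congrArg (fun g => g ⟨_, Submodule.subset_span (Set.mem_range_self o)⟩) hξ
    simp only [LinearMap.comp_apply, Submodule.subtype_apply] at h1
    rw [h1]
    rw [Finsupp.lapply_apply, h.repr_eq_single o _ (by rfl), Finsupp.single_apply]
  refine ⟨contractCoprod ξ, fun w => ?_⟩
  have h1 := contractCoprod_wordProd hd w ξ
  have h2 : ξ 1 = 0 := by simpa using hval none
  have h3 : ∀ j, ξ (e j).1 = if j = i then 1 else 0 := fun j => by simpa using hval (some j)
  simpa [h2, h3] using h1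

theorem linearIndependent_wordProd_toEnv [Fintype ι] [DecidableEq ι] {d : ι → ZMod 2}
    (e : Module.Basis ι ℂ (osp m n)) (hd : ∀ i, IsHomogeneous (d i) (e i).1)
    (hone : ∀ X : osp m n, X.1 ≠ 1) {J : Type*} {l : J → List ι}
    (hinj : Function.Injective fun j => (l j : Multiset ι))
    (hgood : ∀ j, IsSuperMultiset d (l j : Multiset ι)) :
    LinearIndependent ℂ fun j => wordProd (fun i => toEnv (e i)) (l j) := by
  choose D hD using exists_isWordDer hd e.linearIndependent hone
  exact linearIndependent_wordProd (spansSuperalgebra_toEnv e.span_eq hd) hD hinj hgood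

theorem adjoin_toEnv {e : ι → osp m n} (he : Submodule.span ℂ (Set.range e) = ⊤) :
    Algebra.adjoin ℂ (Set.range fun i => toEnv (e i)) = ⊤ := by
  have h1 : Algebra.adjoin ℂ (Set.range (toEnv : osp m n → Env m n)) = ⊤ := by
    rw [eq_top_iff]
    rintro u -
    induction u using Env.induction with
    | algebraMap r => exact Subalgebra.algebraMap_mem _ r
    | toEnv X => exact Algebra.subset_adjoin ⟨X, rfl⟩
    | mul u v hu hv => exact mul_mem hu hv
    | add u v hu hv => exact add_mem hu hv
  rw [eq_top_iff, ← h1, Algebra.adjoin_le_iff]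
  rintro _ ⟨X, rfl⟩
  have hX : X ∈ Submodule.span ℂ (Set.range e) := he ▸ Submodule.mem_top
  have := Submodule.mem_map_of_mem (f := toEnv) hX
  rw [Submodule.map_span, ← Set.range_comp] at this
  exact Algebra.span_le_adjoin ℂ _ this

/-- The defining equations force the central diagonal entry to equal its own negative. -/
theorem ne_one_of_mem_osp (X : osp m n) : X.1 ≠ 1 := by
  intro h
  have h1 := (isOsp_iff _).1 X.2 mid mid
  rw [h] at h1
  rw [bar_mid, Matrix.one_apply_eq] at h1
  norm_num [eta_mid, par_mid, superSign] at h1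

end Env

section Raising

variable {m n : ℕ}

/-! ### A homogeneous basis of `osp(2m+1|2n)` -/

/-- The index set of the `c_j^+`, the `⟦c_j^+, c_j^+⟧` with `c_j^+` odd, and the
`⟦c_j^+, c_k^+⟧` with `j < k`. -/
abbrev RaisingIdx (m n : ℕ) : Type :=
  Fin (m + n) ⊕ ({j : Fin (m + n) // deg (m := m) (n := n) j = 1} ⊕ Pair (m + n))

/-- The elements `c_j^+`, `⟦c_j^+, c_j^+⟧ / 2` and `⟦c_j^+, c_k^+⟧`, a basis of a complement
of `𝒫`. -/
def raising : RaisingIdx m n → osp m n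
  | .inl j => cPlus j
  | .inr (.inl j) => (1 / 2 : ℂ) • bracket (cPlus j.1) (cPlus j.1)
  | .inr (.inr q) => bracket (cPlus q.1.1) (cPlus q.1.2)

/-- The parities of the raising elements. -/
def raisingDeg : RaisingIdx m n → ZMod 2
  | .inl j => deg j
  | .inr (.inl _) => 0
  | .inr (.inr q) => deg q.1.1 + deg q.1.2

theorem IsHomogeneous.smul {a : ZMod 2} {X : SMat m n} (hX : IsHomogeneous a X) (r : ℂ) :
    IsHomogeneous a (r • X) := by
  rw [isHomogeneous_iff] at *
  intro i j h
  rw [Matrix.smul_apply, hX i j h, smul_zero]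

theorem isHomogeneous_raising (i : RaisingIdx m n) :
    IsHomogeneous (raisingDeg i) (raising i).1 := by
  rcases i with j | j | q
  · exact isHomogeneous_cPlus j
  · have h := isHomogeneous_bracket (isHomogeneous_cPlus j.1) (isHomogeneous_cPlus j.1)
    rw [CharTwo.add_self_eq_zero] at h
    exact h.smul _
  · exact isHomogeneous_bracket (isHomogeneous_cPlus _) (isHomogeneous_cPlus _)

theorem bracket_cPlus_cPlus (s t : Fin (m + n)) :
    (bracket (cPlus s) (cPlus t) : osp m n).1 =
      (-2 : ℂ) • (superSign (deg t) (deg t) • Matrix.single (top s) (bot t) 1 -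
        (superSign (deg s) (deg t) * superSign (deg s) (deg s)) •
          Matrix.single (top t) (bot s) 1) := by
  change superBracket _ _ = _
  rw [superBracket_of_homogeneous (isHomogeneous_cPlus s) (isHomogeneous_cPlus t)]
  simp only [cPlus, sqrt_smul_mul]
  simp only [Matrix.smul_mul, Matrix.mul_smul, mul_sub, sub_mul, single_mul_single, if_true,
    (top_ne_mid _).symm, bot_ne_mid, if_false, (top_ne_bot _ _).symm]
  module

theorem sqrt_two_ne_zero : ((Real.sqrt 2 : ℝ) : ℂ) ≠ 0 := by
  intro h; have := sqrt_two_mul; rw [h] at this; norm_num at this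

/-- The coordinates with respect to the raising elements. -/
def raisingCoord : osp m n →ₗ[ℂ] RaisingIdx m n → ℂ :=
  LinearMap.pi fun i =>
    let entry (a b : Idx m n) : osp m n →ₗ[ℂ] ℂ :=
      Matrix.entryLinearMap ℂ ℂ a b ∘ₗ (osp m n).subtype
    match i with
    | .inl j => ((Real.sqrt 2 : ℝ) : ℂ)⁻¹ • entry (top j) mid
    | .inr (.inl j) => (1 / 2 : ℂ) • entry (top j.1) (bot j.1)
    | .inr (.inr q) =>
      (-(1 / 2) * superSign (deg q.1.2) (deg q.1.2)) • entry (top q.1.1) (bot q.1.2)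

theorem raisingCoord_inl (X : osp m n) (j : Fin (m + n)) :
    raisingCoord X (.inl j) = ((Real.sqrt 2 : ℝ) : ℂ)⁻¹ * X.1 (top j) mid := rfl

theorem raisingCoord_inr_inl (X : osp m n) (j) :
    raisingCoord X (.inr (.inl j)) = 1 / 2 * X.1 (top j.1) (bot j.1) := rfl

theorem raisingCoord_inr_inr (X : osp m n) (q : Pair (m + n)) :
    raisingCoord X (.inr (.inr q)) =
      -(1 / 2) * superSign (deg q.1.2) (deg q.1.2) * X.1 (top q.1.1) (bot q.1.2) := rfl

theorem raisingCoord_raising (i : RaisingIdx m n) :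
    raisingCoord (raising i) = Pi.single i 1 := by
  have hc : ∀ j : Fin (m + n), (cPlus j : osp m n).1 = ((Real.sqrt 2 : ℝ) : ℂ) •
      (Matrix.single (top j) mid 1 -
        superSign (deg j) (deg j) • Matrix.single mid (bot j) 1) := fun _ => rfl
  have h1 : superSign 1 1 = -1 := by simp [superSign]
  ext k
  rcases i with i | i | i <;> rcases k with k | k | k <;>
    simp only [raisingCoord_inl, raisingCoord_inr_inl, raisingCoord_inr_inr, raising,
      bracket_cPlus_cPlus, hc, Submodule.coe_smul, Matrix.smul_apply, Matrix.sub_apply,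
      Matrix.single_apply, top_inj, bot_inj, (top_ne_mid _).symm, bot_ne_mid,
      (bot_ne_mid _).symm, Pi.single_apply, smul_eq_mul, Sum.inl.injEq, Sum.inr.injEq,
      reduceCtorEq, if_false, and_false, false_and, mul_zero, sub_zero, and_true]
  · by_cases h : i = k
    · simp [h]
    · simp [h, Ne.symm h]
  · by_cases h : i = k
    · subst h
      simp [i.2, h1]
      norm_num
    · have : ¬ (i.1 = k.1) := fun h' => h (Subtype.ext h')
      simp [Ne.symm h, this]
  · have : ∀ j, ¬ (j = k.1.1 ∧ j = k.1.2) := by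
      rintro j ⟨rfl, h⟩
      exact absurd k.2 (by rw [← h]; exact lt_irrefl _)
    simp [this]
  · have : ∀ j, ¬ (i.1.1 = j ∧ i.1.2 = j) := by
      rintro j ⟨rfl, h⟩
      exact absurd i.2 (by rw [← h]; exact lt_irrefl _)
    have h' : ∀ j, ¬ (i.1.2 = j ∧ i.1.1 = j) := fun j h => this j h.symm
    simp [this, h']
  -- The second matrix unit of the bracket has its indices in decreasing order and is invisible to
  -- the coordinates, which read entries with increasing indices.
  · have h' : ¬ (i.1.2 = k.1.1 ∧ i.1.1 = k.1.2) := by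
      rintro ⟨h1, h2⟩
      have := i.2
      have := k.2
      omega
    by_cases h : i = k
    · subst h
      have := superSign_mul_self (deg i.1.2) (deg i.1.2 : ZMod 2)
      simp only [h', if_true, and_self, if_false]
      linear_combination this
    · have h2 : ¬ (i.1.1 = k.1.1 ∧ i.1.2 = k.1.2) :=
        fun h2 => h (Subtype.ext (Prod.ext h2.1 h2.2))
      simp [h', h2, Ne.symm h]

/-- The parabolic consists of the matrices without entries of positive degree for `level`, and the
defining equations of `osp m n` reduce these entries to the ones recorded by `raisingCoord`. -/
theorem raisingCoord_eq_zero {X : osp m n} : raisingCoord X = 0 ↔ X ∈ parabolic m n := by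
  rw [mem_parabolic_iff]
  have ho := (isOsp_iff _).1 X.2
  constructor
  · intro h
    have h1 : ∀ s, X.1 (top s) mid = 0 := by
      intro s
      have := congrFun h (.inl s)
      rw [raisingCoord_inl] at this
      simpa [sqrt_two_ne_zero] using this
    have h2 : ∀ s t, s < t → X.1 (top s) (bot t) = 0 := by
      intro s t hst
      have := congrFun h (.inr (.inr ⟨(s, t), hst⟩))
      rw [raisingCoord_inr_inr] at this
      simpa [superSign_ne_zero] using this
    -- Entries at (s, t) and (t, s) agree up to sign. On the diagonal the entry vanishes
    -- automatically for even `s` and is one of the coordinates for odd `s`.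
    have h3 : ∀ s t, X.1 (top s) (bot t) = 0 := by
      intro s t
      have hh := ho (bot s) (bot t)
      simp only [bar_bot, par_bot] at hh
      rcases lt_trichotomy s t with hst | rfl | hst
      · exact h2 s t hst
      · by_cases hs : deg s = (1 : ZMod 2)
        · have := congrFun h (.inr (.inl ⟨s, hs⟩))
          rw [raisingCoord_inr_inl] at this
          simpa using this
        · simp only [eta_bot, superSign, hs, false_and, if_false, one_mul] at hh
          exact self_eq_neg.1 hh
      · rw [h2 t s hst] at hh
        simpa [eta_bot, superSign_ne_zero] using hh
    intro i j hij
    obtain ⟨s, rfl⟩ | ⟨s, rfl⟩ | rfl := idx_cases i <;>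
    obtain ⟨t, rfl⟩ | ⟨t, rfl⟩ | rfl := idx_cases j <;>
    simp [level_top, level_bot, level_mid] at hij
    · exact h3 s t
    · exact h1 s
    · have hh := ho mid (bot t)
      simpa [bar_mid, bar_bot, h1, eta_mid] using hh
  · intro h
    ext i
    rcases i with i | i | i
    · rw [raisingCoord_inl, h _ _ (by simp [level_top, level_mid])]; simp
    · rw [raisingCoord_inr_inl, h _ _ (by simp [level_top, level_bot])]; simp
    · rw [raisingCoord_inr_inr, h _ _ (by simp [level_top, level_bot])]; simp

/-- The given spanning set consists of homogeneous elements, so any basis extracted from it is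
homogeneous. -/
theorem exists_homogeneous_basis_parabolic (m n : ℕ) :
    ∃ (κ : Type) (_ : Fintype κ) (f : κ → osp m n) (d : κ → ZMod 2),
      (∀ k, IsHomogeneous (d k) (f k).1) ∧ LinearIndependent ℂ f ∧
      Submodule.span ℂ (Set.range f) = parabolic m n := by
  obtain ⟨b, hb, hspan, hli⟩ := exists_linearIndependent ℂ
    (Set.range cMinus ∪ {X | ∃ j k, X = bracket (cPlus j) (cMinus k)} ∪
      {X | ∃ j k, X = bracket (cMinus j) (cMinus k)} : Set (osp m n))
  have hd : ∀ k : b, ∃ a, IsHomogeneous a k.1.1 := by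
    rintro ⟨X, hX⟩
    obtain (⟨j, rfl⟩ | ⟨j, k, rfl⟩) | ⟨j, k, rfl⟩ := hb hX
    · exact ⟨_, isHomogeneous_cMinus j⟩
    · exact ⟨_, isHomogeneous_bracket (isHomogeneous_cPlus j) (isHomogeneous_cMinus k)⟩
    · exact ⟨_, isHomogeneous_bracket (isHomogeneous_cMinus j) (isHomogeneous_cMinus k)⟩
  choose d hd using hd
  have : Finite b := hli.finite
  refine ⟨b, Fintype.ofFinite b, Subtype.val, d, hd, hli, ?_⟩
  rw [Subtype.range_coe, hspan]
  rfl

theorem linearIndependent_raising : LinearIndependent ℂ (raising : RaisingIdx m n → osp m n) := by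
  refine LinearIndependent.of_comp raisingCoord ?_
  have : raisingCoord ∘ raising = fun i : RaisingIdx m n => (Pi.single i 1 : _ → ℂ) :=
    funext raisingCoord_raising
  rw [this]
  exact Pi.linearIndependent_single_one _ ℂ

theorem raisingCoord_sum (a : RaisingIdx m n → ℂ) :
    raisingCoord (∑ i, a i • raising i) = a := by
  rw [map_sum]
  ext k
  simp [raisingCoord_raising, Pi.single_apply]

variable {κ : Type} {f : κ → osp m n}

/-- The basis of `osp(2m+1|2n)` formed by the raising elements and a basis of `𝒫`. -/
def ospBasis (hf : LinearIndependent ℂ f)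
    (hspan : Submodule.span ℂ (Set.range f) = parabolic m n) :
    Module.Basis (RaisingIdx m n ⊕ κ) ℂ (osp m n) :=
  .mk (v := Sum.elim raising f)
    (linearIndependent_raising.sum_type hf (by
      rw [hspan, Submodule.disjoint_def]
      intro X hX hX'
      obtain ⟨a, rfl⟩ := (Submodule.mem_span_range_iff_exists_fun ℂ).1 hX
      rw [← raisingCoord_eq_zero, raisingCoord_sum] at hX'
      simp [hX']))
    (by
      intro X _
      rw [Set.Sum.elim_range, Submodule.span_union, hspan]
      have h : X - ∑ i, raisingCoord X i • raising i ∈ parabolic m n := by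
        rw [← raisingCoord_eq_zero, map_sub, raisingCoord_sum, sub_self]
      rw [← add_sub_cancel (∑ i, raisingCoord X i • raising i) X]
      exact Submodule.add_mem_sup (sum_mem fun i _ => Submodule.smul_mem _ _
        (Submodule.subset_span ⟨i, rfl⟩)) h)

theorem ospBasis_apply (hf : LinearIndependent ℂ f)
    (hspan : Submodule.span ℂ (Set.range f) = parabolic m n) (i : RaisingIdx m n ⊕ κ) :
    ospBasis hf hspan i = Sum.elim raising f i := by
  simp [ospBasis]

/-! ### Words of raising elements -/

theorem mem_pairList {r : ℕ} (q : Pair r) : q ∈ pairList r := by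
  obtain ⟨⟨j, k⟩, h⟩ := q
  simp only [pairList, List.mem_flatMap, List.mem_filterMap, List.mem_finRange, true_and]
  exact ⟨j, k, by simp [show j < k from h]⟩

theorem nodup_pairList (r : ℕ) : (pairList r).Nodup := by
  rw [pairList, List.nodup_flatMap]
  constructor
  · intro j _
    refine (List.nodup_finRange r).filterMap ?_
    intro k l q hk hl
    simp only [Option.mem_def, Option.dite_none_right_eq_some, Option.some.injEq] at hk hl
    obtain ⟨_, rfl⟩ := hk
    obtain ⟨_, h⟩ := hl
    simpa using (congrArg (fun q : Pair r => q.1.2) h).symm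
  · refine (List.nodup_finRange r).imp ?_
    intro j k hjk q hq hq'
    simp only [List.mem_filterMap, Option.dite_none_right_eq_some, Option.some.injEq] at hq hq'
    obtain ⟨_, _, _, rfl⟩ := hq
    obtain ⟨_, _, _, h⟩ := hq'
    exact hjk (congrArg (fun q : Pair r => q.1.1) h).symm

theorem sum_map_pairList {r : ℕ} {M : Type*} [AddCommMonoid M] (g : Pair r → M) :
    ((pairList r).map g).sum = ∑ q, g q := by
  rw [← List.sum_toFinset g (nodup_pairList r)]
  congr 1
  ext q
  simp [mem_pairList]

/-- The word of raising elements that multiplies to `(c_j^+)^k`. -/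
def singleWord (j : Fin (m + n)) (k : ℕ) : List (RaisingIdx m n) :=
  if h : deg (m := m) (n := n) j = 1 then
    List.replicate (k % 2) (.inl j) ++ List.replicate (k / 2) (.inr (.inl ⟨j, h⟩))
  else List.replicate k (.inl j)

/-- The word of raising elements belonging to a vector of the basis. -/
def raisingWord (k : Exponents m n) : List (RaisingIdx m n) :=
  ((List.finRange (m + n)).flatMap fun j => singleWord j (k.single j)) ++
    (pairList (m + n)).flatMap fun q => List.replicate (k.pair q) (.inr (.inr q))

theorem count_inl_raisingWord (k : Exponents m n) (j : Fin (m + n)) :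
    (raisingWord k : Multiset (RaisingIdx m n)).count (.inl j) =
      if deg (m := m) (n := n) j = 1 then k.single j % 2 else k.single j := by
  have h : ∀ i, (singleWord i (k.single i) : Multiset (RaisingIdx m n)).count (.inl j : RaisingIdx m n) =
      if i = j then (if deg (m := m) (n := n) j = 1 then k.single j % 2 else k.single j)
      else 0 := by
    intro i
    obtain rfl | hij := eq_or_ne i j
    all_goals rw [Multiset.coe_count]
    all_goals unfold singleWord
    all_goals split_ifs <;> simp_all [List.count_replicate]
  simp only [Multiset.coe_count] at h ⊢
  simp [raisingWord, List.count_flatMap, Function.comp_def, h, List.count_replicate,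
    ← Fin.sum_univ_def]

theorem count_inr_inl_raisingWord (k : Exponents m n) (j) :
    (raisingWord k : Multiset (RaisingIdx m n)).count (.inr (.inl j)) = k.single j.1 / 2 := by
  have h : ∀ i, (singleWord i (k.single i) : Multiset (RaisingIdx m n)).count (.inr (.inl j) : RaisingIdx m n) =
      if i = j.1 then k.single j.1 / 2 else 0 := by
    intro i
    have := j.2
    rw [Multiset.coe_count]
    unfold singleWord
    split_ifs <;> simp_all [List.count_replicate, Subtype.ext_iff]
  simp only [Multiset.coe_count] at h ⊢
  simp [raisingWord, List.count_flatMap, Function.comp_def, h, List.count_replicate,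
    ← Fin.sum_univ_def]

theorem count_inr_inr_raisingWord (k : Exponents m n) (q) :
    (raisingWord k : Multiset (RaisingIdx m n)).count (.inr (.inr q)) = k.pair q := by
  have h : ∀ i, (singleWord i (k.single i) : Multiset (RaisingIdx m n)).count (.inr (.inr q) : RaisingIdx m n) = 0 := by
    intro i
    rw [Multiset.coe_count]
    unfold singleWord
    split_ifs <;> simp [List.count_replicate]
  simp only [Multiset.coe_count] at h ⊢
  simp [raisingWord, List.count_flatMap, Function.comp_def, h, List.count_replicate,
    sum_map_pairList]

theorem Exponents.ext {k l : Exponents m n} (h1 : k.single = l.single) (h2 : k.pair = l.pair) :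
    k = l := by
  cases k; cases l; simp_all

theorem raisingWord_injective :
    Function.Injective fun k : Exponents m n => (raisingWord k : Multiset (RaisingIdx m n)) := by
  intro k l h
  have hc : ∀ i, (raisingWord k : Multiset (RaisingIdx m n)).count i =
      (raisingWord l : Multiset (RaisingIdx m n)).count i := fun i =>
    congrArg (Multiset.count i) h
  refine Exponents.ext (funext fun j => ?_) (funext fun q => ?_)
  · have h1 := hc (.inl j)
    rw [count_inl_raisingWord, count_inl_raisingWord] at h1
    split_ifs at h1 with hj
    · have h2 := hc (.inr (.inl ⟨j, hj⟩))
      rw [count_inr_inl_raisingWord, count_inr_inl_raisingWord] at h2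
      simp only at h2
      omega
    · exact h1
  · have h1 := hc (.inr (.inr q))
    rwa [count_inr_inr_raisingWord, count_inr_inr_raisingWord] at h1

theorem isSuperMultiset_raisingWord (k : Exponents m n) :
    IsSuperMultiset raisingDeg (raisingWord k : Multiset (RaisingIdx m n)) := by
  rintro (j | j | q) h
  · rw [count_inl_raisingWord, if_pos (show deg (m := m) (n := n) j = 1 from h)]
    omega
  · exact absurd h (by simp [raisingDeg])
  · rw [count_inr_inr_raisingWord]
    exact k.pair_le q h

theorem exists_raisingWord {s : Multiset (RaisingIdx m n)} (hs : IsSuperMultiset raisingDeg s) :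
    ∃ k : Exponents m n, (raisingWord k : Multiset (RaisingIdx m n)) = s := by
  -- For odd `j` the letter c_j^+ occurs at most once and is the remainder modulo 2 of the exponent;
  -- the letters (c_j^+)² supply the quotient.
  refine ⟨⟨fun j => s.count (.inl j) +
      if h : deg (m := m) (n := n) j = 1 then 2 * s.count (.inr (.inl ⟨j, h⟩)) else 0,
    fun q => s.count (.inr (.inr q)), fun q hq => hs (.inr (.inr q)) hq⟩, ?_⟩
  ext i
  rcases i with j | j | q
  · rw [count_inl_raisingWord]
    by_cases h : deg (m := m) (n := n) j = 1
    · have := hs (.inl j) h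
      simp only [h, if_true, dite_true]
      omega
    · simp [h]
  · rw [count_inr_inl_raisingWord]
    obtain ⟨j, hj⟩ := j
    have := hs (.inl j) hj
    simp only [hj, dite_true]
    omega
  · rw [count_inr_inr_raisingWord]

theorem toEnv_raising_inr_inl (j) :
    toEnv (raising (.inr (.inl j)) : osp m n) = toEnv (cPlus j.1) ^ 2 := by
  have h := toEnv_supercomm (isHomogeneous_cPlus (m := m) (n := n) j.1) (isHomogeneous_cPlus j.1)
  rw [raising, map_smul, ← h, j.2]
  simp only [superSign, and_self, if_true, sq]
  module

theorem wordProd_flatMap {A ι ι' : Type*} [Ring A] (x : ι → A) (L : List ι') (g : ι' → List ι) :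
    wordProd x (L.flatMap g) = (L.map fun i => wordProd x (g i)).prod := by
  induction L with
  | nil => rfl
  | cons i L ih => simp [wordProd_append, ih]

theorem wordProd_replicate {A ι : Type*} [Ring A] (x : ι → A) (k : ℕ) (i : ι) :
    wordProd x (List.replicate k i) = x i ^ k := by
  simp [wordProd]

theorem wordProd_raisingWord (k : Exponents m n) :
    wordProd (fun i => toEnv (raising i)) (raisingWord k) =
      ((List.finRange (m + n)).map fun j => toEnv (cPlus j) ^ k.single j).prod *
        ((pairList (m + n)).map fun q =>
          toEnv (bracket (cPlus q.1.1) (cPlus q.1.2)) ^ k.pair q).prod := by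
  rw [raisingWord, wordProd_append, wordProd_flatMap, wordProd_flatMap]
  congr 2
  · refine List.map_congr_left fun j _ => ?_
    unfold singleWord
    split_ifs with h
    · rw [wordProd_append, wordProd_replicate, wordProd_replicate, toEnv_raising_inr_inl,
        ← pow_mul, raising, ← pow_add, Nat.mod_add_div]
    · rw [wordProd_replicate, raising]
  · refine List.map_congr_left fun q _ => ?_
    rw [wordProd_replicate, raising]

end Raising

section Basis

variable {m n : ℕ}

/-! ### The basis of the induced module -/

/-- The action on the vacuum. -/
def actVacuum (p : ℂ) : Env m n →ₗ[ℂ] VBar m n p :=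
  (LinearMap.toSpanSingleton (Env m n) (VBar m n p) (vacuum m n p)).restrictScalars ℂ

theorem actVacuum_apply (p : ℂ) (u : Env m n) : actVacuum p u = u • vacuum m n p := rfl

theorem actVacuum_eq_mk (p : ℂ) (u : Env m n) :
    actVacuum p u = Submodule.Quotient.mk (u ⊗ₜ[ℂ] (1 : ℂ)) := by
  rw [actVacuum_apply, vacuum, ← Submodule.Quotient.mk_smul, TensorProduct.smul_tmul', smul_eq_mul,
    mul_one]

theorem actVacuum_surjective (p : ℂ) : Function.Surjective (actVacuum (m := m) (n := n) p) := by
  intro v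
  obtain ⟨t, rfl⟩ := Submodule.Quotient.mk_surjective _ v
  obtain ⟨u, rfl⟩ := (TensorProduct.rid ℂ (Env m n)).symm.surjective t
  exact ⟨u, by rw [actVacuum_eq_mk]; simp⟩

theorem pbwVector_eq (p : ℂ) (k : Exponents m n) :
    pbwVector p k = actVacuum p (wordProd (fun i => toEnv (raising i)) (raisingWord k)) := by
  rw [wordProd_raisingWord]; rfl

variable {κ : Type} {f : κ → osp m n} {d : κ → ZMod 2}

theorem actVacuum_mul_wordProd (p : ℂ) (hmem : ∀ k, f k ∈ parabolic m n) (u : Env m n)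
    (w : List κ) : actVacuum p (u * wordProd (fun k => toEnv (f k)) w) =
      (w.map fun k => vacuumFunctional p (f k)).prod • actVacuum p u := by
  have h : wordProd (fun k => toEnv (f k)) w • vacuum m n p =
      (w.map fun k => vacuumFunctional p (f k)).prod • vacuum m n p := by
    induction w with
    | nil => simp
    | cons k w ih =>
      rw [wordProd_cons, mul_smul, ih, smul_comm (toEnv (f k)) (_ : ℂ), smul_vacuum p (hmem k),
        smul_smul, List.map_cons, List.prod_cons, mul_comm]
  rw [actVacuum_apply, mul_smul, h, smul_comm u (_ : ℂ), actVacuum_apply]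

/-- The vacuum functional is a character of the parabolic, so the graph of this functional inside
`Env m n × ℂ` is closed under the supercommutator, and words can be straightened in both components
with the same coefficients. -/
theorem spansSuperalgebra_vacuum (p : ℂ)
    (hspan : Submodule.span ℂ (Set.range f) = parabolic m n)
    (hd : ∀ k, IsHomogeneous (d k) (f k).1) :
    SpansSuperalgebra (fun k => ((toEnv (f k), vacuumFunctional p (f k)) : Env m n × ℂ)) d := by
  intro i j
  have hmem : ∀ k, f k ∈ parabolic m n := fun k => hspan ▸ Submodule.subset_span ⟨k, rfl⟩
  have h := bracket_mem_parabolic (hmem i) (hmem j)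
  rw [← hspan] at h
  have h' := Submodule.mem_map_of_mem (f := toEnv.prod (vacuumFunctional p)) h
  rw [Submodule.map_span, ← Set.range_comp] at h'
  have e : ((toEnv (f i), vacuumFunctional p (f i)) * (toEnv (f j), vacuumFunctional p (f j)) -
      superSign (d i) (d j) • ((toEnv (f j), vacuumFunctional p (f j)) *
        (toEnv (f i), vacuumFunctional p (f i))) : Env m n × ℂ) =
      toEnv.prod (vacuumFunctional p) (bracket (f i) (f j)) := Prod.ext
    (toEnv_supercomm (hd i) (hd j))
    (vacuumFunctional_isCharacter p (hmem i) (hmem j) (hd i) (hd j)).symm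
  change _ - _ ∈ _
  rw [e]
  exact h'

/-- The ordered words in a basis of `osp(2m+1|2n)`, with the raising elements first. -/
def pbwWord (j : Exponents m n × Multiset κ) : List (RaisingIdx m n ⊕ κ) :=
  (raisingWord j.1).map .inl ++ j.2.toList.map .inr

theorem wordProd_pbwWord (hf : LinearIndependent ℂ f)
    (hspan : Submodule.span ℂ (Set.range f) = parabolic m n) (j : Exponents m n × Multiset κ) :
    wordProd (fun i => toEnv (ospBasis hf hspan i)) (pbwWord j) =
      wordProd (fun i => toEnv (raising i)) (raisingWord j.1) *
        wordProd (fun k => toEnv (f k)) j.2.toList := by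
  rw [pbwWord, wordProd_append]
  simp [wordProd, Function.comp_def, ospBasis_apply]

theorem coe_pbwWord (j : Exponents m n × Multiset κ) : (pbwWord j : Multiset _) =
    (raisingWord j.1 : Multiset (RaisingIdx m n)).map Sum.inl + j.2.map Sum.inr := by
  rw [pbwWord, ← Multiset.coe_add, ← Multiset.map_coe, ← Multiset.map_coe, Multiset.coe_toList]

theorem count_inl_add {α β : Type*} [DecidableEq α] [DecidableEq β] (s : Multiset α)
    (t : Multiset β) (a : α) : (s.map Sum.inl + t.map Sum.inr).count (Sum.inl a) = s.count a := by
  rw [Multiset.count_add, Multiset.count_map_eq_count' _ _ Sum.inl_injective,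
    Multiset.count_eq_zero.2 (show Sum.inl a ∉ t.map Sum.inr by simp), add_zero]

theorem count_inr_add {α β : Type*} [DecidableEq α] [DecidableEq β] (s : Multiset α)
    (t : Multiset β) (b : β) : (s.map Sum.inl + t.map Sum.inr).count (Sum.inr b) = t.count b := by
  rw [Multiset.count_add, Multiset.count_map_eq_count' _ _ Sum.inr_injective,
    Multiset.count_eq_zero.2 (show Sum.inr b ∉ s.map Sum.inl by simp), zero_add]

theorem exists_map_inl_add_map_inr {α β : Type*} (s : Multiset (α ⊕ β)) :
    ∃ (a : Multiset α) (b : Multiset β), a.map Sum.inl + b.map Sum.inr = s := by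
  induction s using Multiset.induction with
  | empty => exact ⟨0, 0, rfl⟩
  | cons i s ih =>
    obtain ⟨a, b, rfl⟩ := ih
    rcases i with i | i
    · exact ⟨i ::ₘ a, b, by simp⟩
    · exact ⟨a, i ::ₘ b, by simp⟩

variable [DecidableEq κ]

theorem pbwWord_injective : Function.Injective fun j : Exponents m n × Multiset κ =>
    (pbwWord j : Multiset (RaisingIdx m n ⊕ κ)) := by
  rintro ⟨k, s⟩ ⟨l, t⟩ h
  simp only [coe_pbwWord] at h
  refine Prod.ext (raisingWord_injective (Multiset.ext.2 fun a => ?_)) (Multiset.ext.2 fun b => ?_)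
  · simpa only [count_inl_add] using congrArg (Multiset.count (Sum.inl a)) h
  · simpa only [count_inr_add] using congrArg (Multiset.count (Sum.inr b)) h

theorem isSuperMultiset_pbwWord {j : Exponents m n × Multiset κ} (hj : IsSuperMultiset d j.2) :
    IsSuperMultiset (Sum.elim raisingDeg d) (pbwWord j : Multiset (RaisingIdx m n ⊕ κ)) := by
  rw [coe_pbwWord]
  rintro (i | i) hi
  · rw [count_inl_add]
    exact isSuperMultiset_raisingWord j.1 i hi
  · rw [count_inr_add]
    exact hj i hi

theorem exists_pbwWord {s : Multiset (RaisingIdx m n ⊕ κ)}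
    (hs : IsSuperMultiset (Sum.elim raisingDeg d) s) :
    ∃ j : Exponents m n × {t : Multiset κ // IsSuperMultiset d t},
      (pbwWord (j.1, j.2.1) : Multiset (RaisingIdx m n ⊕ κ)) = s := by
  obtain ⟨a, b, rfl⟩ := exists_map_inl_add_map_inr s
  obtain ⟨k, hk⟩ := exists_raisingWord (s := a) fun i hi => by
    simpa only [count_inl_add] using hs (.inl i) hi
  refine ⟨(k, ⟨b, fun i hi => ?_⟩), by rw [coe_pbwWord, hk]⟩
  simpa only [count_inr_add] using hs (.inr i) hi

variable [Fintype κ]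

/-- The Poincaré–Birkhoff–Witt basis of the enveloping algebra of `osp(2m+1|2n)`. -/
def pbwBasis (hf : LinearIndependent ℂ f)
    (hspan : Submodule.span ℂ (Set.range f) = parabolic m n)
    (hd : ∀ k, IsHomogeneous (d k) (f k).1) :
    Module.Basis (Exponents m n × {t : Multiset κ // IsSuperMultiset d t}) ℂ (Env m n) :=
  have hd' : ∀ i, IsHomogeneous (Sum.elim raisingDeg d i) (ospBasis hf hspan i).1 := by
    intro i
    rw [ospBasis_apply]
    rcases i with i | i
    · exact isHomogeneous_raising i
    · exact hd i
  .mk (v := fun j => wordProd (fun i => toEnv (ospBasis hf hspan i)) (pbwWord (j.1, j.2.1)))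
    (linearIndependent_wordProd_toEnv (ospBasis hf hspan) hd' ne_one_of_mem_osp
      (fun j j' h => by
        have := pbwWord_injective h
        rw [Prod.mk.injEq] at this
        exact Prod.ext this.1 (Subtype.ext this.2))
      fun j => isSuperMultiset_pbwWord j.2.2)
    (span_wordProd_eq_top (spansSuperalgebra_toEnv (ospBasis hf hspan).span_eq hd')
      (adjoin_toEnv (ospBasis hf hspan).span_eq) fun _ hs => exists_pbwWord hs).ge

theorem pbwBasis_apply (hf : LinearIndependent ℂ f)
    (hspan : Submodule.span ℂ (Set.range f) = parabolic m n)
    (hd : ∀ k, IsHomogeneous (d k) (f k).1) (j) :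
    pbwBasis hf hspan hd j = wordProd (fun i => toEnv (raising i)) (raisingWord j.1) *
      wordProd (fun k => toEnv (f k)) j.2.1.toList := by
  rw [pbwBasis, Module.Basis.mk_apply, wordProd_pbwWord]

/-- The projection of the enveloping algebra to the span of the words of raising elements along
the relations of the induced module. -/
def vacuumProj (p : ℂ) (hf : LinearIndependent ℂ f)
    (hspan : Submodule.span ℂ (Set.range f) = parabolic m n)
    (hd : ∀ k, IsHomogeneous (d k) (f k).1) : Env m n →ₗ[ℂ] Exponents m n →₀ ℂ :=
  (pbwBasis hf hspan hd).constr ℂ fun j =>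
    Finsupp.single j.1 ((j.2.1.toList.map fun k => vacuumFunctional p (f k)).prod)

/-- By construction this holds for the chosen ordered words; the point is that `w` may be in any
order and may repeat odd letters. Straightening in `Env m n × ℂ` reduces it to the ordered case. -/
theorem vacuumProj_word (p : ℂ) (hf : LinearIndependent ℂ f)
    (hspan : Submodule.span ℂ (Set.range f) = parabolic m n)
    (hd : ∀ k, IsHomogeneous (d k) (f k).1) (k : Exponents m n) (w : List κ) :
    vacuumProj p hf hspan hd (wordProd (fun i => toEnv (raising i)) (raisingWord k) *
      wordProd (fun k => toEnv (f k)) w) =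
      Finsupp.single k ((w.map fun k => vacuumFunctional p (f k)).prod) := by
  let x : κ → Env m n × ℂ := fun k => (toEnv (f k), vacuumFunctional p (f k))
  have hx : ∀ w, wordProd x w = (wordProd (fun k => toEnv (f k)) w,
      (w.map fun k => vacuumFunctional p (f k)).prod) := by
    intro w
    induction w with
    | nil => rfl
    | cons i w ih => rw [wordProd_cons, ih]; simp [x]
  have h := wordProd_mem_span (spansSuperalgebra_vacuum p hspan hd)
    (l := fun t : {t : Multiset κ // IsSuperMultiset d t} => t.1.toList)
    (fun s hs => ⟨⟨s, hs⟩, Multiset.coe_toList s⟩) w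
  change wordProd x w ∈ Submodule.span ℂ (Set.range fun t : {t : Multiset κ // _} =>
    wordProd x t.1.toList) at h
  -- Both sides are linear in the pair `v`, so only ordered words need checking.
  have key : ∀ v ∈ Submodule.span ℂ (Set.range fun t : {t : Multiset κ // IsSuperMultiset d t} =>
      wordProd x t.1.toList), vacuumProj p hf hspan hd
        (wordProd (fun i => toEnv (raising i)) (raisingWord k) * v.1) = Finsupp.single k v.2 := by
    intro v hv
    induction hv using Submodule.span_induction with
    | zero => simp
    | add u v _ _ hu hv => simp [mul_add, hu, hv]
    | smul r u _ hu => simp [hu]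
    | mem v hv =>
      obtain ⟨t, rfl⟩ := hv
      simp only [hx]
      rw [← pbwBasis_apply hf hspan hd (k, t), vacuumProj, Module.Basis.constr_basis]
  have := key _ h
  rwa [hx] at this

/-- Appending a letter to a basis word spoils the order only in its parabolic part, where
`vacuumProj_word` allows any order. -/
theorem vacuumProj_mul (p : ℂ) (hf : LinearIndependent ℂ f)
    (hspan : Submodule.span ℂ (Set.range f) = parabolic m n)
    (hd : ∀ k, IsHomogeneous (d k) (f k).1) {X : osp m n} (hX : X ∈ parabolic m n)
    (u : Env m n) : vacuumProj p hf hspan hd (u * toEnv X) =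
      vacuumFunctional p X • vacuumProj p hf hspan hd u := by
  rw [← hspan] at hX
  induction hX using Submodule.span_induction with
  | zero => simp
  | add X Y _ _ hX hY => simp [mul_add, hX, hY, add_smul]
  | smul r X _ hX => simp [hX, smul_smul]
  | mem X hX =>
    obtain ⟨i, rfl⟩ := hX
    have h : vacuumProj p hf hspan hd ∘ₗ LinearMap.mulRight ℂ (toEnv (f i)) =
        vacuumFunctional p (f i) • vacuumProj p hf hspan hd := by
      refine (pbwBasis hf hspan hd).ext fun j => ?_
      have e : wordProd (fun k => toEnv (f k)) j.2.1.toList * toEnv (f i) =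
          wordProd (fun k => toEnv (f k)) (j.2.1.toList ++ [i]) := by
        rw [wordProd_append]; simp
      rw [LinearMap.comp_apply, LinearMap.mulRight_apply, LinearMap.smul_apply, pbwBasis_apply,
        mul_assoc, e, vacuumProj_word, vacuumProj_word]
      simp [mul_comm]
    exact LinearMap.congr_fun h u

theorem vacuumProj_eq_zero (p : ℂ) (hf : LinearIndependent ℂ f)
    (hspan : Submodule.span ℂ (Set.range f) = parabolic m n)
    (hd : ∀ k, IsHomogeneous (d k) (f k).1) {u : Env m n} (hu : actVacuum p u = 0) :
    vacuumProj p hf hspan hd u = 0 := by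
  rw [actVacuum_eq_mk, Submodule.Quotient.mk_eq_zero] at hu
  -- `vacuumProj` is only ℂ-linear, whereas the relations form an `Env`-submodule; the left
  -- multiplier `e` carries the induction through scalar multiplication.
  have key : ∀ t ∈ inducedRel (parabolic m n) (vacuumAction m n p), ∀ e : Env m n,
      vacuumProj p hf hspan hd (TensorProduct.rid ℂ (Env m n) (e • t)) = 0 := by
    intro t ht
    induction ht using Submodule.span_induction with
    | zero => simp
    | add s t _ _ hs ht => intro e; rw [smul_add, map_add, map_add, hs, ht, add_zero]
    | smul r t _ ht => intro e; rw [smul_smul, ht]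
    | mem t ht =>
      intro e
      obtain ⟨u, X, w, rfl⟩ := ht
      rw [smul_sub, TensorProduct.smul_tmul', TensorProduct.smul_tmul', map_sub,
        TensorProduct.rid_tmul, TensorProduct.rid_tmul, smul_eq_mul, smul_eq_mul, ← mul_assoc,
        map_sub, LinearMap.map_smul, LinearMap.map_smul, vacuumProj_mul p hf hspan hd X.2]
      have : vacuumAction m n p X w = vacuumFunctional p X.1 * w := by
        simp [vacuumAction]
      rw [this, smul_smul, mul_comm, sub_self]
  simpa using key _ hu 1

end Basis

variable {m n : ℕ}

/-- For independence, `vacuumProj` factors through the quotient and sends the raising words to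
distinct free generators. For spanning, the parabolic part of a PBW word acts on the vacuum by a
scalar. -/
theorem exists_basis_pbwVector (m n : ℕ) (p : ℂ) :
    ∃ b : Module.Basis (Exponents m n) ℂ (VBar m n p), ∀ k, b k = pbwVector p k := by
  classical
  obtain ⟨κ, _, f, d, hd, hf, hspan⟩ := exists_homogeneous_basis_parabolic m n
  have hmem : ∀ k, f k ∈ parabolic m n := fun k => hspan ▸ Submodule.subset_span ⟨k, rfl⟩
  refine ⟨.mk (v := pbwVector p) ?_ ?_, fun k => Module.Basis.mk_apply _ _ k⟩
  · rw [linearIndependent_iff]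
    intro a ha
    have h1 : actVacuum p (Finsupp.linearCombination ℂ
        (fun k => wordProd (fun i => toEnv (raising i)) (raisingWord k)) a) = 0 := by
      rw [← ha, Finsupp.apply_linearCombination]
      congr 2
      funext k
      exact (pbwVector_eq p k).symm
    have h2 := vacuumProj_eq_zero p hf hspan hd h1
    rw [Finsupp.apply_linearCombination] at h2
    have h3 : (vacuumProj p hf hspan hd ∘ fun k =>
        wordProd (fun i => toEnv (raising i)) (raisingWord k)) = fun k => Finsupp.single k 1 := by
      funext k
      simpa using vacuumProj_word p hf hspan hd k []
    rw [h3] at h2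
    simpa [Finsupp.linearCombination_apply] using h2
  · rw [top_le_iff, Submodule.eq_top_iff']
    intro v
    obtain ⟨u, rfl⟩ := actVacuum_surjective p v
    have hu := (pbwBasis hf hspan hd).mem_span u
    induction hu using Submodule.span_induction with
    | zero => simp
    | add u v _ _ hu hv => rw [map_add]; exact add_mem hu hv
    | smul r u _ hu => rw [map_smul]; exact Submodule.smul_mem _ _ hu
    | mem u hu =>
      obtain ⟨j, rfl⟩ := hu
      rw [pbwBasis_apply, actVacuum_mul_wordProd p hmem, ← pbwVector_eq]
      exact Submodule.smul_mem _ _ (Submodule.subset_span ⟨_, rfl⟩)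

/-! ### Generating functions -/

section Series

variable {σ : Type*}

open Classical in
/-- The series `∑ X^{e v}`, `e ∈ S`. -/
def powerSum (S : Set ℕ) (v : σ →₀ ℕ) : MvPowerSeries σ ℚ :=
  fun d => if ∃ e ∈ S, e • v = d then 1 else 0

open Classical in
theorem coeff_powerSum (S : Set ℕ) (v d : σ →₀ ℕ) :
    MvPowerSeries.coeff d (powerSum S v) = if ∃ e ∈ S, e • v = d then 1 else 0 := rfl

/-- This is the telescoping of the geometric series; `v ≠ 0` makes the exponents `e • v` distinct.
-/
theorem powerSum_univ_mul {v : σ →₀ ℕ} (hv : v ≠ 0) :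
    powerSum Set.univ v * (1 - MvPowerSeries.monomial v 1) = 1 := by
  classical
  ext d
  rw [mul_sub, mul_one, map_sub, MvPowerSeries.coeff_mul_monomial, mul_one, coeff_powerSum,
    coeff_powerSum, MvPowerSeries.coeff_one]
  simp only [Set.mem_univ, true_and]
  have hnle : ¬ v ≤ 0 := fun h => hv (le_antisymm h zero_le)
  by_cases hd : ∃ e : ℕ, e • v = d
  · obtain ⟨e, rfl⟩ := hd
    cases e with
    | zero => simp [hv]
    | succ e =>
      have h1 : (e + 1) • v - v = e • v := by rw [succ_nsmul, add_tsub_cancel_right]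
      have h2 : v ≤ (e + 1) • v := by rw [succ_nsmul]; exact le_add_self
      have h3 : (e + 1) • v ≠ 0 := fun h => hnle (h ▸ h2)
      rw [if_pos ⟨_, rfl⟩, if_pos h2, h1, if_pos ⟨_, rfl⟩, if_neg h3, sub_self]
  · have h1 : ¬ (v ≤ d ∧ ∃ e : ℕ, e • v = d - v) := by
      rintro ⟨h, e, he⟩
      exact hd ⟨e + 1, by rw [succ_nsmul, he, tsub_add_cancel_of_le h]⟩
    have h2 : d ≠ 0 := fun h => hd ⟨0, by simp [h]⟩
    rw [if_neg hd, if_neg h2, ← ite_and, if_neg h1, sub_zero]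

theorem powerSum_le_one {v : σ →₀ ℕ} (hv : v ≠ 0) :
    powerSum {e | e ≤ 1} v = 1 + MvPowerSeries.monomial v 1 := by
  classical
  ext d
  rw [map_add, coeff_powerSum, MvPowerSeries.coeff_one, MvPowerSeries.coeff_monomial]
  have h : (∃ e ∈ {e : ℕ | e ≤ 1}, e • v = d) ↔ d = 0 ∨ d = v := by
    constructor
    · rintro ⟨e, he, rfl⟩
      obtain rfl | rfl := Nat.le_one_iff_eq_zero_or_eq_one.1 he <;> simp
    · rintro (rfl | rfl)
      · exact ⟨0, by simp, by simp⟩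
      · exact ⟨1, by simp, by simp⟩
  simp only [h]
  by_cases h1 : d = 0
  · simp [h1, hv.symm]
  · simp [h1]

variable {T : Type*} [Fintype T]

/-- The exponents of the terms of a product of series `∑ X^{e v}`. -/
def exponentEquiv [DecidableEq σ] [DecidableEq T] (S : T → Set ℕ) {v : T → σ →₀ ℕ}
    (hv : ∀ t, v t ≠ 0) (d : σ →₀ ℕ) :
    {e : T → ℕ // (∀ t, e t ∈ S t) ∧ ∑ t, e t • v t = d} ≃
      {l : T →₀ σ →₀ ℕ // l ∈ Finset.finsuppAntidiag Finset.univ d ∧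
        ∀ t, ∃ e ∈ S t, e • v t = l t} :=
  .ofBijective (fun e => ⟨Finsupp.equivFunOnFinite.symm fun t => e.1 t • v t, by
    simpa [Finset.mem_finsuppAntidiag] using ⟨e.2.2, fun t => ⟨_, e.2.1 t, rfl⟩⟩⟩) (by
    constructor
    · intro e e' h
      refine Subtype.ext (funext fun t => ?_)
      have h1 := DFunLike.congr_fun (Subtype.ext_iff.1 h) t
      simp only [Finsupp.equivFunOnFinite_symm_apply_apply] at h1
      obtain ⟨i, hi⟩ := Finsupp.ne_iff.1 (hv t)
      have h2 := DFunLike.congr_fun h1 i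
      simp only [Finsupp.smul_apply, smul_eq_mul] at h2
      exact Nat.eq_of_mul_eq_mul_right (Nat.pos_of_ne_zero hi) h2
    · rintro ⟨l, hl, h⟩
      have h' := h
      choose e he hel using h'
      rw [Finset.mem_finsuppAntidiag] at hl
      refine ⟨⟨e, he, by simpa only [hel] using hl.1⟩, ?_⟩
      ext1
      ext1 t
      simp [hel])

/-- Choosing one term from each factor amounts to choosing exponents `e t ∈ S t`, since `v t ≠ 0`
lets `e t` be recovered from `e t • v t`. -/
theorem coeff_prod_powerSum (S : T → Set ℕ) {v : T → σ →₀ ℕ} (hv : ∀ t, v t ≠ 0)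
    (d : σ →₀ ℕ) :
    MvPowerSeries.coeff d (∏ t, powerSum (S t) (v t)) =
      Nat.card {e : T → ℕ // (∀ t, e t ∈ S t) ∧ ∑ t, e t • v t = d} := by
  classical
  rw [MvPowerSeries.coeff_prod, Nat.card_congr (exponentEquiv S hv d)]
  simp only [coeff_powerSum, Finset.prod_boole, Finset.mem_univ, true_imp_iff, Finset.sum_boole]
  rw [Nat.subtype_card ((Finset.finsuppAntidiag Finset.univ d).filter
    fun l => ∀ t, ∃ e ∈ S t, e • v t = l t)]
  simp

theorem finite_exponents (S : T → Set ℕ) {v : T → σ →₀ ℕ} (hv : ∀ t, v t ≠ 0)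
    (d : σ →₀ ℕ) : Finite {e : T → ℕ // (∀ t, e t ∈ S t) ∧ ∑ t, e t • v t = d} := by
  classical
  have : Finite {l : T →₀ σ →₀ ℕ // l ∈ Finset.finsuppAntidiag Finset.univ d ∧
      ∀ t, ∃ e ∈ S t, e • v t = l t} :=
    Set.Finite.subset (Finset.finite_toSet (Finset.finsuppAntidiag Finset.univ d))
      fun l hl => hl.1
  exact Finite.of_equiv _ (exponentEquiv S hv d).symm

end Series

/-! ### The generating function of the exponents -/

section Count

variable {m n : ℕ}

/-- The degree of a vector of the basis in the variables `x` and `y`. -/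
def Exponents.degree (k : Exponents m n) : Fin (m + n) →₀ ℕ :=
  ∑ j, k.single j • Finsupp.single j 1 +
    ∑ q, k.pair q • (Finsupp.single q.1.1 1 + Finsupp.single q.1.2 1)

/-- The degrees of the elements `c_j^+` and `⟦c_j^+, c_k^+⟧`. -/
def factorDegree : Fin (m + n) ⊕ Pair (m + n) → Fin (m + n) →₀ ℕ
  | .inl j => Finsupp.single j 1
  | .inr q => Finsupp.single q.1.1 1 + Finsupp.single q.1.2 1

/-- The possible exponents of the elements `c_j^+` and `⟦c_j^+, c_k^+⟧`. -/
def factorExponents : Fin (m + n) ⊕ Pair (m + n) → Set ℕ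
  | .inl _ => Set.univ
  | .inr q => if deg (m := m) (n := n) q.1.1 + deg (m := m) (n := n) q.1.2 = 1
      then {e | e ≤ 1} else Set.univ

theorem factorDegree_ne_zero (t : Fin (m + n) ⊕ Pair (m + n)) : factorDegree t ≠ 0 := by
  rcases t with j | q
  · simp [factorDegree]
  · intro h
    have := DFunLike.congr_fun h q.1.1
    simp [factorDegree] at this

/-- The exponents of given degree as functions. -/
def exponentsEquiv (d : Fin (m + n) →₀ ℕ) : {k : Exponents m n // k.degree = d} ≃
    {e : Fin (m + n) ⊕ Pair (m + n) → ℕ //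
      (∀ t, e t ∈ factorExponents t) ∧ ∑ t, e t • factorDegree t = d} where
  toFun k := ⟨Sum.elim k.1.single k.1.pair, by
    constructor
    · rintro (j | q)
      · trivial
      · have := k.1.pair_le q
        simp only [factorExponents, Sum.elim_inr]
        split_ifs with h
        · exact this h
        · trivial
    · rw [Fintype.sum_sum_type]
      exact k.2⟩
  invFun e := ⟨⟨fun j => e.1 (.inl j), fun q => e.1 (.inr q), fun q hq => by
    have := e.2.1 (.inr q)
    rwa [factorExponents, if_pos hq] at this⟩, by
      have := e.2.2
      rwa [Fintype.sum_sum_type] at this⟩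
  left_inv _ := rfl
  right_inv e := by
    ext (j | q) <;> rfl

instance (d : Fin (m + n) →₀ ℕ) : Finite {k : Exponents m n // k.degree = d} :=
  have := finite_exponents factorExponents (v := factorDegree (m := m) (n := n))
    factorDegree_ne_zero d
  .of_equiv _ (exponentsEquiv d).symm

theorem prod_Ioi {r : ℕ} {M : Type*} [CommMonoid M] (i : Fin r) (g : Fin r → M) :
    ∏ k ∈ Finset.Ioi i, g k = ∏ k, if i < k then g k else 1 := by
  rw [← Finset.prod_filter]
  congr 1
  ext k
  simp

/-- Parafermions precede parabosons, so every mixed pair occurs exactly once in increasing order. -/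
theorem prod_pair {M : Type*} [CommMonoid M] (g : Fin (m + n) → Fin (m + n) → M) :
    ∏ q : Pair (m + n), g q.1.1 q.1.2 =
      (∏ i : Fin m, ∏ k ∈ Finset.Ioi i, g (Fin.castAdd n i) (Fin.castAdd n k)) *
      (∏ i : Fin m, ∏ j : Fin n, g (Fin.castAdd n i) (Fin.natAdd m j)) *
      ∏ j : Fin n, ∏ l ∈ Finset.Ioi j, g (Fin.natAdd m j) (Fin.natAdd m l) := by
  have h : ∏ q : Pair (m + n), g q.1.1 q.1.2 =
      ∏ j, ∏ k, if j < k then g j k else 1 := by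
    rw [← Fintype.prod_prod_type' (f := fun j k => if j < k then g j k else 1),
      ← Finset.prod_filter]
    exact (Finset.prod_subtype _ (by simp) fun q : Fin (m + n) × Fin (m + n) => g q.1 q.2).symm
  have h1 : ∀ (i : Fin m) (j : Fin n), Fin.castAdd n i < Fin.natAdd m j := fun i j => by
    rw [Fin.lt_def, Fin.val_castAdd, Fin.val_natAdd]; omega
  have h2 : ∀ i k : Fin m, Fin.castAdd n i < Fin.castAdd n k ↔ i < k := fun _ _ => Iff.rfl
  rw [h]
  simp only [prod_Ioi, Fin.prod_univ_add, h1, (h1 _ _).not_gt, if_true, if_false,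
    Finset.prod_const_one, mul_one, mul_assoc, Finset.prod_mul_distrib, h2,
    Fin.natAdd_lt_natAdd_iff]

theorem prod_powerSum_mul_denominator :
    (∏ t : Fin (m + n) ⊕ Pair (m + n), powerSum (factorExponents t) (factorDegree t)) *
      denominator m n = numerator m n := by
  let X (j : Fin (m + n)) : MvPowerSeries (Fin (m + n)) ℚ := MvPowerSeries.X j
  -- A pair of equal parity contributes only to the denominator, a mixed pair only to the numerator.
  let D (j k : Fin (m + n)) : MvPowerSeries (Fin (m + n)) ℚ :=
    if deg (m := m) (n := n) j + deg (m := m) (n := n) k = 1 then 1 else 1 - X j * X k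
  let N (j k : Fin (m + n)) : MvPowerSeries (Fin (m + n)) ℚ :=
    if deg (m := m) (n := n) j + deg (m := m) (n := n) k = 1 then 1 + X j * X k else 1
  have h11 : (1 : ZMod 2) + 1 ≠ 1 := by decide
  have h00 : (0 : ZMod 2) ≠ 1 := by decide
  have hD : denominator m n = (∏ j, (1 - X j)) * ∏ q : Pair (m + n), D q.1.1 q.1.2 := by
    rw [prod_pair, Fin.prod_univ_add]
    simp only [D, deg_castAdd, deg_natAdd, add_zero, zero_add, h11, h00, if_true, if_false,
      Finset.prod_const_one, mul_one]
    simp only [denominator, x, y, X]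
    ring
  have hN : numerator m n = ∏ q : Pair (m + n), N q.1.1 q.1.2 := by
    rw [prod_pair]
    simp only [N, deg_castAdd, deg_natAdd, add_zero, zero_add, h11, h00, if_true, if_false,
      Finset.prod_const_one, mul_one, one_mul]
    rfl
  rw [hD, hN, Fintype.prod_sum_type, mul_mul_mul_comm, ← Finset.prod_mul_distrib,
    ← Finset.prod_mul_distrib]
  have hq : ∀ q : Pair (m + n), MvPowerSeries.monomial (factorDegree (.inr q)) 1 =
      X q.1.1 * X q.1.2 := by
    intro q
    simp only [X, MvPowerSeries.X_def, MvPowerSeries.monomial_mul_monomial, mul_one]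
    rfl
  rw [Finset.prod_eq_one, one_mul]
  · refine Finset.prod_congr rfl fun q _ => ?_
    simp only [factorExponents, D, N]
    split_ifs
    · rw [powerSum_le_one (factorDegree_ne_zero _), hq, mul_one]
    · rw [← hq, powerSum_univ_mul (factorDegree_ne_zero _)]
  · intro j _
    exact powerSum_univ_mul (factorDegree_ne_zero (.inl j))

/-- The denominator has constant coefficient 1, so its formal inverse is a genuine inverse. -/
theorem card_exponents_degree (d : Fin (m + n) →₀ ℕ) :
    (Nat.card {k : Exponents m n // k.degree = d} : ℚ) =
      MvPowerSeries.coeff d (numerator m n * (denominator m n)⁻¹) := by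
  have h : MvPowerSeries.constantCoeff (denominator m n) ≠ 0 := by
    simp [denominator, x, y, map_prod]
  rw [← (MvPowerSeries.eq_mul_inv_iff_mul_eq h).2 prod_powerSum_mul_denominator,
    coeff_prod_powerSum factorExponents factorDegree_ne_zero d, Nat.card_congr (exponentsEquiv d)]

end Count

section Weights

variable {m n : ℕ}

/-! ### Weights -/

theorem isHomogeneous_cartan (j : Fin (m + n)) : IsHomogeneous 0 (cartan j : osp m n).1 := by
  rw [isHomogeneous_iff]
  intro i k h
  have h1 : ∀ a : Idx m n, ¬ (a = i ∧ a = k) := by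
    rintro a ⟨rfl, rfl⟩
    exact h (CharTwo.add_self_eq_zero _)
  simp [cartan, h1]

theorem bracket_cartan_cPlus (j s : Fin (m + n)) :
    (bracket (cartan j) (cPlus s) : osp m n) = (if s = j then (1 : ℂ) else 0) • cPlus s := by
  apply Subtype.ext
  change superBracket _ _ = _ • (cPlus s : osp m n).1
  rw [superBracket_of_homogeneous (isHomogeneous_cartan j) (isHomogeneous_cPlus s)]
  simp only [cPlus, cartan, Matrix.smul_mul, Matrix.mul_smul, mul_sub, sub_mul, single_mul_single,
    top_inj, bot_inj, top_ne_mid, bot_ne_mid, (top_ne_bot _ _).symm, if_false,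
    superSign_zero_left, (top_ne_mid _).symm, (bot_ne_mid _).symm]
  by_cases h : s = j
  · subst h
    simp only [if_true]
    module
  · simp [h, Ne.symm h]

/-- `u` has weight `μ` under the commutator with the Cartan elements. -/
def HasWeight (u : Env m n) (μ : Fin (m + n) → ℂ) : Prop :=
  ∀ j, toEnv (cartan j) * u = u * toEnv (cartan j) + μ j • u

theorem HasWeight.one : HasWeight (1 : Env m n) 0 := fun j => by simp

theorem HasWeight.mul {u v : Env m n} {μ ν : Fin (m + n) → ℂ} (hu : HasWeight u μ)
    (hv : HasWeight v ν) : HasWeight (u * v) (μ + ν) := fun j => by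
  rw [← mul_assoc, hu j, add_mul, mul_assoc, hv j, mul_add, smul_mul_assoc, mul_smul_comm,
    Pi.add_apply, mul_assoc]
  module

theorem HasWeight.pow {u : Env m n} {μ : Fin (m + n) → ℂ} (hu : HasWeight u μ) (k : ℕ) :
    HasWeight (u ^ k) (k • μ) := by
  induction k with
  | zero => simpa using HasWeight.one
  | succ k ih => rw [pow_succ, succ_nsmul]; exact ih.mul hu

theorem HasWeight.list_prod {α : Type*} (L : List α) {u : α → Env m n}
    {μ : α → Fin (m + n) → ℂ} (h : ∀ a, HasWeight (u a) (μ a)) :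
    HasWeight (L.map u).prod (L.map μ).sum := by
  induction L with
  | nil => simpa using HasWeight.one
  | cons a L ih => simpa using (h a).mul ih

theorem hasWeight_cPlus (s : Fin (m + n)) :
    HasWeight (toEnv (cPlus s : osp m n)) (Pi.single s 1) := fun j => by
  have h := toEnv_supercomm (isHomogeneous_cartan j) (isHomogeneous_cPlus (m := m) (n := n) s)
  rw [bracket_cartan_cPlus, map_smul, superSign_zero_left, one_smul] at h
  rw [Pi.single_apply, ← sub_eq_iff_eq_add', h]
  simp only [eq_comm]

/-- In the enveloping algebra the superbracket is a combination of the two products, which have the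
same weight. -/
theorem hasWeight_bracket (s t : Fin (m + n)) :
    HasWeight (toEnv (bracket (cPlus s) (cPlus t) : osp m n))
      (Pi.single s 1 + Pi.single t 1) := fun j => by
  have h1 := (hasWeight_cPlus (m := m) (n := n) s).mul (hasWeight_cPlus t) j
  have h2 := (hasWeight_cPlus (m := m) (n := n) t).mul (hasWeight_cPlus s) j
  rw [← toEnv_supercomm (isHomogeneous_cPlus s) (isHomogeneous_cPlus t), mul_sub, sub_mul,
    mul_smul_comm, smul_mul_assoc, h1, h2, add_comm (Pi.single t 1)]
  module

theorem cartan_mem_parabolic (j : Fin (m + n)) : cartan j ∈ parabolic m n := by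
  rw [mem_parabolic_iff]
  intro i k h
  have h1 : ∀ a : Idx m n, ¬ (a = i ∧ a = k) := by
    rintro a ⟨rfl, rfl⟩
    exact lt_irrefl _ h
  simp [cartan, h1]

theorem vacuumFunctional_cartan (p : ℂ) (j : Fin (m + n)) :
    vacuumFunctional p (cartan j : osp m n) = lowestWeight p j := by
  simp [vacuumFunctional_apply, cartan, Matrix.single_apply, top_inj, (top_ne_bot _ _).symm]

/-- The weight of a vector of the basis. -/
def Exponents.weight (p : ℂ) (k : Exponents m n) (j : Fin (m + n)) : ℂ :=
  lowestWeight p j + (k.degree j : ℂ)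

theorem cartan_smul_pbwVector (p : ℂ) (k : Exponents m n) (j : Fin (m + n)) :
    toEnv (cartan j : osp m n) • pbwVector p k = k.weight p j • pbwVector p k := by
  have h := (HasWeight.list_prod (List.finRange (m + n)) fun i =>
    (hasWeight_cPlus (m := m) (n := n) i).pow (k.single i)).mul
    (HasWeight.list_prod (pairList (m + n)) fun q =>
      (hasWeight_bracket (m := m) (n := n) q.1.1 q.1.2).pow (k.pair q)) j
  rw [pbwVector, smul_smul, h, add_smul, mul_smul _ (toEnv (cartan j)),
    smul_vacuum p (cartan_mem_parabolic j), vacuumFunctional_cartan, smul_comm _ (_ : ℂ),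
    smul_assoc, ← add_smul, sum_map_pairList, ← Fin.sum_univ_def]
  congr 1
  simp [Exponents.weight, Exponents.degree, Finsupp.single_apply, Pi.single_apply,
    Finset.sum_add_distrib, eq_comm]

/-- The `T i` are diagonal in the basis `b`, so a joint eigenvector can only have nonzero
coordinates at basis vectors of the same weight. -/
theorem iInf_eigenspace_eq_span {V ι K : Type*} [AddCommGroup V] [Module ℂ V]
    (b : Module.Basis K ℂ V) (T : ι → Module.End ℂ V) (w : K → ι → ℂ)
    (h : ∀ k i, T i (b k) = w k i • b k) (μ : ι → ℂ) :
    ⨅ i, Module.End.eigenspace (T i) (μ i) = Submodule.span ℂ (b '' {k | w k = μ}) := by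
  refine le_antisymm (fun v hv => ?_) (Submodule.span_le.2 ?_)
  · rw [Module.Basis.mem_span_image]
    intro k hk
    have hk' : b.repr v k ≠ 0 := by simpa using hk
    refine funext fun i => ?_
    have h1 : b.coord k ∘ₗ T i = w k i • b.coord k := by
      refine b.ext fun l => ?_
      by_cases hl : l = k
      · simp [h, hl]
      · simp [h, hl]
    have h2 := LinearMap.congr_fun h1 v
    have h3 := Module.End.mem_eigenspace_iff.1 ((Submodule.mem_iInf _).1 hv i)
    simp only [LinearMap.comp_apply, h3, map_smul, LinearMap.smul_apply, Module.Basis.coord_apply,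
      smul_eq_mul] at h2
    exact (mul_right_cancel₀ hk' h2).symm
  · rintro _ ⟨k, rfl, rfl⟩
    exact (Submodule.mem_iInf _).2 fun i => Module.End.mem_eigenspace_iff.2 (h k i)

/-- In characteristic zero the weight determines the degree, and only finitely many exponents share
a degree. -/
theorem finite_weight (p : ℂ) (μ : Fin (m + n) → ℂ) :
    {k : Exponents m n | k.weight p = μ}.Finite := by
  by_cases h : ∃ k : Exponents m n, k.weight p = μ
  · obtain ⟨l, rfl⟩ := h
    refine Set.Finite.subset (s := {k : Exponents m n | k.degree = l.degree})
      (inferInstanceAs (Finite {k : Exponents m n // k.degree = l.degree})) fun k hk => ?_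
    refine Finsupp.ext fun j => ?_
    simpa [Exponents.weight] using congrFun hk j
  · convert Set.finite_empty
    ext k
    simpa using fun hk => h ⟨k, hk⟩

end Weights

end Osp

end

/-! ### Basis, weight decomposition and character -/

theorem mainTheorem4 (m n : ℕ) (p : ℂ) :
    (∃ b : Module.Basis (Osp.Exponents m n) ℂ (Osp.VBar m n p),
      ∀ k, b k = Osp.pbwVector p k) ∧
    ((⨆ μ, Osp.weightSpace (m := m) (n := n) (Osp.VBar m n p) μ) = ⊤) ∧
    (∀ μ, Module.Finite ℂ (Osp.weightSpace (m := m) (n := n) (Osp.VBar m n p) μ)) ∧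
    Osp.character (m := m) (n := n) (Osp.VBar m n p) =
      Osp.monomialMul (Osp.lowestWeight p) (Osp.numerator m n * (Osp.denominator m n)⁻¹) := by
  obtain ⟨b, hb⟩ := Osp.exists_basis_pbwVector m n p
  have hw : ∀ μ, Osp.weightSpace (m := m) (n := n) (Osp.VBar m n p) μ =
      Submodule.span ℂ (b '' {k | k.weight p = μ}) := fun μ =>
    Osp.iInf_eigenspace_eq_span b _ (fun k => k.weight p) (fun k j => by
      rw [hb]; exact Osp.cartan_smul_pbwVector p k j) μ
  refine ⟨⟨b, hb⟩, ?_, fun μ => ?_, funext fun μ => ?_⟩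
  · rw [eq_top_iff, ← b.span_eq, Submodule.span_le]
    rintro _ ⟨k, rfl⟩
    refine Submodule.mem_iSup_of_mem (k.weight p) ?_
    rw [hw]
    exact Submodule.subset_span ⟨k, rfl, rfl⟩
  · rw [hw]
    exact .span_of_finite ℂ ((Osp.finite_weight p μ).image b)
  · have hcard : Osp.character (m := m) (n := n) (Osp.VBar m n p) μ =
        (Nat.card {k : Osp.Exponents m n // k.weight p = μ} : ℚ) := by
      have : Fintype {k : Osp.Exponents m n // k.weight p = μ} :=
        (Osp.finite_weight (m := m) (n := n) p μ).fintype
      have h := finrank_span_eq_card (b.linearIndependent.comp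
        ((↑) : {k : Osp.Exponents m n // k.weight p = μ} → _) Subtype.val_injective)
      rw [Osp.character, hw, Nat.card_eq_fintype_card, Set.image_eq_range]
      exact congrArg _ h
    rw [hcard, Osp.monomialMul]
    have hinj : Function.Injective fun (d : Fin (m + n) →₀ ℕ) (j : Fin (m + n)) =>
        Osp.lowestWeight (m := m) (n := n) p j + (d j : ℂ) := fun d e h =>
      Finsupp.ext fun j => by simpa using congrFun h j
    by_cases h : ∃ d : Fin (m + n) →₀ ℕ,
        (fun j => Osp.lowestWeight (m := m) (n := n) p j + (d j : ℂ)) = μ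
    · obtain ⟨d, rfl⟩ := h
      rw [hinj.extend_apply, ← Osp.card_exponents_degree]
      congr 1
      refine Nat.card_congr (Equiv.subtypeEquivRight fun k => ?_)
      exact hinj.eq_iff (a := k.degree)
    -- Off the translate of ℕ^(m+n) by the lowest weight, the series has coefficient 0 by the
    -- default of `Function.extend`, and no basis vector has this weight.
    · rw [Function.extend_apply' _ _ _ h]
      have : IsEmpty {k : Osp.Exponents m n // k.weight p = μ} :=
        ⟨fun k => h ⟨k.1.degree, k.2⟩⟩
      simp
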